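/- **Setting (network revenue management).** There are $m$ resources and $n$ demand types. In each of $T$ periods one query arrives, independently of the others. It has type $j$ with probability $p_j>0$ ($\sum_j p_j=1$); a query of type $j$ consumes $\bm a_j=(a_{j,1},\dots,a_{j,m})\in\mathbb R^m_{\ge0}$ if it is served, and its reward $r$ is drawn from a law $F_j$ supported on $[l_j,u_j]$ with $0\le l_j\le u_j$. If $l_j<u_j$, then $F_j$ has a density that is at least $\alpha>0$ on $[l_j,u_j]$; if $l_j=u_j$, then $F_j$ is the point mass at $l_j$. Each query must be served or rejected irrevocably on arrival, and it can be served only if the remaining capacities $\bm c$ satisfy $\bm c\ge\bm a_j$. For capacities $\bm c\ge 0$ and numbers $d_j\in\mathbb Z_{\ge0}$ of remaining queries of each type, the semi-fluid relaxation is $$\bar V_{\bm c}(\bm d)=\max\Big\{\sum_j d_j\,\mathbb E_{r\sim F_j}[r\,x_j(r)]\ :\ \sum_j d_j a_{j,i}\,\mathbb E_{r\sim F_j}[x_j(r)]\le c_i\ \forall i,\ \ x_j(r)\in[0,1]\Big\}.$$ For weights $w\in\mathbb R^n_{\ge0}$ let $P_{\bm c}(w)$ be the problem of maximizing $\sum_j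 w_j\int_{1-q_j}^1F_j^{-1}(z)\,dz$ subject to $\sum_j w_ja_{j,i}q_j\le c_i$ for all $i$ and $q\in[0,1]^n$. The fluid problem with $s$ remaining periods is $P_{\bm c}((p_js)_j)$; let $\hat q^{s,\bm c}$ be an optimal solution of it, chosen arbitrarily for each $s\ge1$ and $\bm c\ge0$. Call $\kappa_1>0$ a *sensitivity constant* if for all $s\ge1$, $\bm c\ge0$, all $\bm d\in\mathbb Z_{\ge0}^n$ with $\sum_jd_j=s$ and every optimal solution $\hat q$ of the fluid problem there is an optimal solution $\tilde q$ of $P_{\bm c}(\bm d)$ with $\max_j|\hat q_j-\tilde q_j|\le\kappa_1\max_j|d_j/s-p_j|$. **Policy $\pi$.** At period $t$, with $s=T-t+1$ and remaining capacities $\bm c$, put $\varepsilon_s=3\kappa_1\sqrt{\log s/s}$. A query of type $j$ and reward $r$ is served if and only if $\bm c\ge\bm a_j$ and $r\ge\hat M$, where $\hat M=l_j$ if $\hat q^{s,\bm c}_j\ge1-\varepsilon_s$; otherwise, if $\hat q^{s,\bm c}_j\le\varepsilon_s$, then $\hat M=u_j$ when $l_j<u_j$ and $\hat M=u_j+1$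 when $l_j=u_j$ (so that the query is rejected almost surely); otherwise $\hat M=F_j^{-1}(1-\hat q^{s,\bm c}_j)$. Let $x_t\in\{0,1\}$ be the decision. With $\tilde d_{j,t}$ the number of type-$j$ queries in periods $t,\dots,T$, the myopic regret at $\bm c$ is $$\mathrm{Myopic}_t(\pi,\bm c)=\mathbb E\big[\bar V_{\bm c}(\tilde{\bm d}_t)-\bar V_{\bm c-\bm a_{j_t}x_t}(\tilde{\bm d}_{t+1})-r_tx_t\big].$$ The regret of $\pi$ started from capacities $\bm C$ is the expected hindsight (integral) optimum minus the expected total reward of $\pi$. **Theorem.** There is a constant $s_0$ that depends only on $(p_j)_j$ such that the following holds for all $(\bm a_j)_j$. 1. There is a $\kappa_1>0$, depending only on $(p_j)_j$ and $(\bm a_j)_j$, that is a sensitivity constant for all reward laws as above. 2. For all $\kappa_1,\alpha>0$ and $U\in\mathbb R$ there is a constant $\kappa_2>0$ (depending only on $(p_j),(\bm a_j),\kappa_1,\alpha,U$) such that, for all reward laws as above with $\max_ju_j\le U$ for which $\kappa_1$ is a sensitivity constant, and for every choice of the solutions $\hat q^{s,\bm c}$: $$\mathrm{Myopic}_t(\pi,\bm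 c)\le\frac{\kappa_2\log s}{s}\qquad\text{for all } T,\ t\in\{1,\dots,T\},\ \bm c\ge0 \text{ with } s=T-t+1\ge s_0,$$ and $$\mathrm{Regret}(\pi)\le\kappa_2\log^2T\qquad\text{for all } T\ge2 \text{ and all initial capacities } \bm C\ge0.$$ -/

import Mathlib

open MeasureTheory ProbabilityTheory

/-!  Network revenue management with finitely many demand types.

Indices: `i : Fin m` is a resource, `j : Fin n` a demand type, `t : Fin T` a period, numbered from
`0`, so that `T - t` is the number of remaining periods, the current one included.
A query is a pair `(j, r) : Fin n × ℝ` (type and reward); a problem instance is a sequence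
`I : Fin T → Fin n × ℝ` of queries. `a j i` is the amount of resource `i` that a query of type `j`
consumes and `p j` is the probability of type `j`. -/

namespace NRM

noncomputable section

/-- Reward data: for each type `j`, the law `F j` of the reward of a query of type `j`, and the end
points `l j`, `u j` of its support. -/
structure Rewards (n : ℕ) where
  F : Fin n → Measure ℝ
  l : Fin n → ℝ
  u : Fin n → ℝ

/-- For each type, `0 ≤ l ≤ u` and the reward law is a probability measure, which is either given by
a Lebesgue density on `[l, u]` that is at least `α` there or, if `l = u`, the point mass at `l`. -/
def Rewards.DensityBoundedBelow {n : ℕ} (R : Rewards n) (α : ℝ) : Prop :=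
  ∀ j, 0 ≤ R.l j ∧ IsProbabilityMeasure (R.F j) ∧
    ((R.l j < R.u j ∧ ∃ f : ℝ → ENNReal, Measurable f ∧
        (∀ r ∈ Set.Icc (R.l j) (R.u j), ENNReal.ofReal α ≤ f r) ∧
        R.F j = (volume.restrict (Set.Icc (R.l j) (R.u j))).withDensity f) ∨
      (R.l j = R.u j ∧ R.F j = Measure.dirac (R.l j)))

/-- The law of one query: type `j` with probability `p j`, then a reward drawn from `F j`. -/
def queryLaw {n : ℕ} (p : Fin n → ℝ) (R : Rewards n) : Measure (Fin n × ℝ) :=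
  ∑ j, ENNReal.ofReal (p j) • (R.F j).map (fun r => (j, r))

/-- The law of a problem instance: `T` independent queries. -/
def instanceLaw {n : ℕ} (p : Fin n → ℝ) (R : Rewards n) (T : ℕ) :
    Measure (Fin T → Fin n × ℝ) :=
  Measure.pi fun _ => queryLaw p R

/-- The quantile function (generalized inverse of the distribution function) of a law on `ℝ`;
only its values on `(0, 1]` matter. -/
def quantile (μ : Measure ℝ) (q : ℝ) : ℝ :=
  sInf {x : ℝ | q ≤ cdf μ x}

/-- The semi-fluid relaxation with capacities `c` and `d j` remaining queries of type `j`: the optimal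
value of the problem of choosing acceptance rules `x j : ℝ → [0, 1]`. -/
def semiFluid {m n : ℕ} (a : Fin n → Fin m → ℝ) (R : Rewards n) (c : Fin m → ℝ)
    (d : Fin n → ℕ) : ℝ :=
  sSup {v : ℝ | ∃ x : Fin n → ℝ → ℝ,
    (∀ j, Measurable (x j)) ∧ (∀ j r, x j r ∈ Set.Icc (0 : ℝ) 1) ∧
    (∀ i, ∑ j, (d j : ℝ) * a j i * ∫ r, x j r ∂(R.F j) ≤ c i) ∧
    v = ∑ j, (d j : ℝ) * ∫ r, r * x j r ∂(R.F j)}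

/-- Feasibility of acceptance proportions `q` when there are `w j` queries of type `j`. -/
def IsFeasibleProportion {m n : ℕ} (a : Fin n → Fin m → ℝ) (w : Fin n → ℝ)
    (c : Fin m → ℝ) (q : Fin n → ℝ) : Prop :=
  (∀ j, q j ∈ Set.Icc (0 : ℝ) 1) ∧ ∀ i, ∑ j, w j * a j i * q j ≤ c i

/-- The reward of accepting the best proportion `q j` of `w j` queries of each type `j`. -/
def proportionReward {n : ℕ} (R : Rewards n) (w : Fin n → ℝ) (q : Fin n → ℝ) : ℝ :=
  ∑ j, w j * ∫ z in (1 - q j)..1, quantile (R.F j) z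

/-- `q` is an optimal vector of acceptance proportions. For `w j = p j * s` this is the fluid
(ex-ante) problem, for `w j = d j` it is the semi-fluid problem in quantile form. -/
def IsOptimalProportion {m n : ℕ} (a : Fin n → Fin m → ℝ) (R : Rewards n) (w : Fin n → ℝ)
    (c : Fin m → ℝ) (q : Fin n → ℝ) : Prop :=
  IsFeasibleProportion a w c q ∧
    ∀ q', IsFeasibleProportion a w c q' → proportionReward R w q' ≤ proportionReward R w q

/-- `κ` is a sensitivity constant: every optimal solution of the fluid problem with `s` remaining
periods is within `κ * max_j |d j / s - p j|` (in sup norm) of an optimal solution of the semi-fluid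
problem, for every vector `d` of type counts of `s` queries and all capacities. -/
def IsSensitivityConstant {m n : ℕ} (p : Fin n → ℝ) (a : Fin n → Fin m → ℝ) (R : Rewards n)
    (κ : ℝ) : Prop :=
  ∀ (s : ℕ) (c : Fin m → ℝ) (d : Fin n → ℕ) (qf : Fin n → ℝ),
    1 ≤ s → (∀ i, 0 ≤ c i) → ∑ j, d j = s →
    IsOptimalProportion a R (fun j => p j * s) c qf →
    ∃ qs : Fin n → ℝ, IsOptimalProportion a R (fun j => (d j : ℝ)) c qs ∧
      ∀ j, |qf j - qs j| ≤ κ * ⨆ k, |(d k : ℝ) / s - p k|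

/-- `qhat` solves the fluid problem for every positive number `s` of remaining periods and all
remaining capacities `c`. -/
def IsFluidSolver {m n : ℕ} (p : Fin n → ℝ) (a : Fin n → Fin m → ℝ) (R : Rewards n)
    (qhat : ℕ → (Fin m → ℝ) → Fin n → ℝ) : Prop :=
  ∀ (s : ℕ) (c : Fin m → ℝ), 1 ≤ s → (∀ i, 0 ≤ c i) →
    IsOptimalProportion a R (fun j => p j * s) c (qhat s c)

/-- The boundary-attracted threshold with `s` remaining periods and remaining capacities `c`, for a
query of type `j`. Near the lower boundary the threshold must lead to rejection: `u j` does so almost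
surely if `l j < u j`; for a point mass (`l j = u j`) a value above `u j` is taken. -/
def boundaryEstimator {m n : ℕ} (R : Rewards n) (κ : ℝ)
    (qhat : ℕ → (Fin m → ℝ) → Fin n → ℝ) (s : ℕ) (c : Fin m → ℝ) (j : Fin n) : ℝ :=
  open Classical in
  if 1 - 3 * κ * √(Real.log s / s) ≤ qhat s c j then R.l j
  else if qhat s c j ≤ 3 * κ * √(Real.log s / s) then
    (if R.l j < R.u j then R.u j else R.u j + 1)
  else quantile (R.F j) (1 - qhat s c j)

/-- The decision (`1` for serving, `0` for rejecting) of the threshold policy with estimator `M` on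
a query `x`, with `s` remaining periods and remaining capacities `c`. -/
def decision {m n : ℕ} (a : Fin n → Fin m → ℝ) (M : ℕ → (Fin m → ℝ) → Fin n → ℝ)
    (s : ℕ) (c : Fin m → ℝ) (x : Fin n × ℝ) : ℝ :=
  open Classical in
  if M s c x.1 ≤ x.2 ∧ ∀ i, a x.1 i ≤ c i then 1 else 0

/-- Capacities that remain after the decision on the query `x`. -/
def nextCapacity {m n : ℕ} (a : Fin n → Fin m → ℝ) (M : ℕ → (Fin m → ℝ) → Fin n → ℝ)
    (s : ℕ) (c : Fin m → ℝ) (x : Fin n × ℝ) : Fin m → ℝ :=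
  fun i => c i - a x.1 i * decision a M s c x

/-- Capacities at the beginning of period `k` when the policy runs on `I` from capacities `C`. -/
def capacityAt {m n : ℕ} (a : Fin n → Fin m → ℝ) (M : ℕ → (Fin m → ℝ) → Fin n → ℝ)
    (C : Fin m → ℝ) {T : ℕ} (I : Fin T → Fin n × ℝ) : ℕ → Fin m → ℝ
  | 0 => C
  | k + 1 =>
    if h : k < T then nextCapacity a M (T - k) (capacityAt a M C I k) (I ⟨k, h⟩)
    else capacityAt a M C I k

/-- The total reward of the policy on the instance `I`. -/
def policyValue {m n : ℕ} (a : Fin n → Fin m → ℝ) (M : ℕ → (Fin m → ℝ) → Fin n → ℝ)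
    (C : Fin m → ℝ) {T : ℕ} (I : Fin T → Fin n × ℝ) : ℝ :=
  ∑ t : Fin T, (I t).2 * decision a M (T - (t : ℕ)) (capacityAt a M C I (t : ℕ)) (I t)

/-- The offline (hindsight) optimum on the instance `I`. -/
def offlineValue {m n : ℕ} (a : Fin n → Fin m → ℝ) (C : Fin m → ℝ) {T : ℕ}
    (I : Fin T → Fin n × ℝ) : ℝ :=
  sSup {v : ℝ | ∃ x : Fin T → ℝ, (∀ t, x t = 0 ∨ x t = 1) ∧
    (∀ i, ∑ t, a (I t).1 i * x t ≤ C i) ∧ v = ∑ t, (I t).2 * x t}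

/-- The regret of the policy against the expected offline optimum. -/
def regret {m n : ℕ} (p : Fin n → ℝ) (a : Fin n → Fin m → ℝ) (R : Rewards n)
    (M : ℕ → (Fin m → ℝ) → Fin n → ℝ) (T : ℕ) (C : Fin m → ℝ) : ℝ :=
  (∫ I, offlineValue a C I ∂(instanceLaw p R T)) - ∫ I, policyValue a M C I ∂(instanceLaw p R T)

/-- The number of queries of type `j` among the periods `k, k + 1, …` of `I`. -/
def remainingCount {n T : ℕ} (I : Fin T → Fin n × ℝ) (k : ℕ) (j : Fin n) : ℕ :=
  (Finset.univ.filter fun t : Fin T => k ≤ (t : ℕ) ∧ (I t).1 = j).card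

/-- The myopic regret in period `t` at capacities `c`, with respect to the semi-fluid relaxation. -/
def myopicRegret {m n : ℕ} (p : Fin n → ℝ) (a : Fin n → Fin m → ℝ) (R : Rewards n)
    (M : ℕ → (Fin m → ℝ) → Fin n → ℝ) (T : ℕ) (t : Fin T) (c : Fin m → ℝ) : ℝ :=
  ∫ I, (semiFluid a R c (remainingCount I (t : ℕ))
      - semiFluid a R (nextCapacity a M (T - (t : ℕ)) c (I t)) (remainingCount I ((t : ℕ) + 1))
      - (I t).2 * decision a M (T - (t : ℕ)) c (I t)) ∂(instanceLaw p R T)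

end

end NRM

/-! Write `G_j q = ∫ z in (1 - q)..1, F_j⁻¹ z` (`topReward`) for the best reward per query from serving
a proportion `q` of the queries of type `j`. The semi-fluid relaxation is the concave problem of
maximizing `∑ j, d j * G_j (q j)` over feasible proportions (`semiFluid_le_of_optimal`,
`le_semiFluid`), because no acceptance rule beats a threshold (`integral_mul_le_price`).

*Sensitivity.* Let `x` be optimal for the fluid weights `w` and let `z` be the optimal solution for
the weights `w'` that is closest to `x`. Suppose that some nonzero direction has the signs of `z - x`
and does not point out of the constraints that are tight at `x`, while its opposite does not point out
of those tight at `z`. By concavity, moving `x` along it and `z` against it does not decrease the sum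
of the two objectives, so `z` could be moved closer to `x` (`eq_zero_of_exchange`). Hence the cone of
such directions is trivial. As there are only finitely many sign patterns and sets of tight
constraints, compactness bounds every vector with these signs by a multiple of its violation of the
constraints, uniformly in the reward laws (`exists_uniform_bound`). The violation of
`w * (z - x)` is of the order of `w' - w`.

*One period.* Fix the capacities and the types of the later queries, and let the current query have
type `j`. Compare with the optimal proportions `q` for the actual type counts `d`: whether or not the
query is served, adjust the proportion of type `j` for the remaining `d j - 1` queries so that the
total number served stays `d j * q j`. The first order terms cancel, and as the slope of `G_j` is
`1 / α`-Lipschitz (a density bounded below makes the quantile function Lipschitz), the loss is at most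
`((ρ - q j) ^ 2 + 1 / (d j - 1)) / α` if the policy serves with probability `ρ` (`split_loss_le`,
`integral_oneStepLoss_le_of_optimal`). For a point mass `G_j` is linear and nothing is lost. The
adjustment is possible only if `1 ≤ d j * q j` when the query may be served and
`1 ≤ d j * (1 - q j)` when it may be rejected; the pushing of `ρ` to `0` or `1` near the boundary
guarantees this when the counts are typical (`exists_integral_oneStepLoss_le`). By Hoeffding's
inequality they fail to be typical with probability `O(1 / s ^ 2)`, while the loss is never more than
`O(s)`.

*Regret.* The semi-fluid relaxation dominates the hindsight optimum in expectation
(`integral_offlineValue_le`), and its value minus the reward of the policy telescopes into the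
losses of the periods (`policyValue_eq`). The capacities in a period do not depend on its query, so
redrawing that query (`measurePreserving_update`) bounds each expected loss by the bound for fixed
capacities. Summing `log s / s` gives `log ^ 2 T`. -/

namespace NRM

/-! ### Quantile functions -/

section Quantile

variable {μ : Measure ℝ} [IsProbabilityMeasure μ] {l u : ℝ}

lemma cdf_eq_one_of_ae_le (hs : ∀ᵐ r ∂μ, r ∈ Set.Icc l u) : cdf μ u = 1 := by
  rw [cdf_eq_real, measureReal_def]
  have : μ (Set.Iic u) = 1 := by
    rw [prob_compl_eq_zero_iff measurableSet_Iic |>.symm]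
    exact measure_eq_zero_iff_ae_notMem.2 (hs.mono fun r h hr => hr h.2)
  simp [this]

lemma cdf_eq_zero_of_lt (hs : ∀ᵐ r ∂μ, r ∈ Set.Icc l u) {x : ℝ} (hx : x < l) : cdf μ x = 0 := by
  rw [cdf_eq_real, measureReal_def]
  have : μ (Set.Iic x) = 0 := measure_eq_zero_iff_ae_notMem.2
    (hs.mono fun r h hr => absurd (h.1.trans hr) (not_le.2 hx))
  simp [this]

/-- The Galois connection between the quantile function and the distribution function. -/
lemma quantile_le_iff (hs : ∀ᵐ r ∂μ, r ∈ Set.Icc l u) {z x : ℝ} (hz : z ∈ Set.Ioc (0 : ℝ) 1) :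
    quantile μ z ≤ x ↔ z ≤ cdf μ x := by
  have hbdd : BddBelow {x : ℝ | z ≤ cdf μ x} := by
    refine ⟨l, fun y hy => ?_⟩
    by_contra! h
    have := cdf_eq_zero_of_lt hs h
    simp only [Set.mem_ofPred_eq, this] at hy
    exact absurd hz.1 (not_lt.2 hy)
  have hne : {x : ℝ | z ≤ cdf μ x}.Nonempty := ⟨u, by simpa [cdf_eq_one_of_ae_le hs] using hz.2⟩
  constructor
  · intro h
    rw [← (cdf μ).iInf_Ioi_eq x]
    refine le_ciInf fun y => ?_
    obtain ⟨w, hw, hwy⟩ := exists_lt_of_csInf_lt hne (lt_of_le_of_lt h y.2)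
    exact hw.trans (monotone_cdf μ hwy.le)
  · intro h
    exact csInf_le hbdd h

lemma le_cdf_quantile (hs : ∀ᵐ r ∂μ, r ∈ Set.Icc l u) {z : ℝ} (hz : z ∈ Set.Ioc (0 : ℝ) 1) :
    z ≤ cdf μ (quantile μ z) := (quantile_le_iff hs hz).1 le_rfl

lemma quantile_monotoneOn (hs : ∀ᵐ r ∂μ, r ∈ Set.Icc l u) :
    MonotoneOn (quantile μ) (Set.Ioc 0 1) := fun _ hz _ hw h =>
  (quantile_le_iff hs hz).2 (h.trans (le_cdf_quantile hs hw))

lemma quantile_mem_Icc (hs : ∀ᵐ r ∂μ, r ∈ Set.Icc l u) {z : ℝ} (hz : z ∈ Set.Ioc (0 : ℝ) 1) :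
    quantile μ z ∈ Set.Icc l u := by
  constructor
  · by_contra! h
    have := le_cdf_quantile hs hz
    rw [cdf_eq_zero_of_lt hs h] at this
    exact absurd hz.1 (not_lt.2 this)
  · rw [quantile_le_iff hs hz, cdf_eq_one_of_ae_le hs]
    exact hz.2

lemma aemeasurable_quantile (hs : ∀ᵐ r ∂μ, r ∈ Set.Icc l u) :
    AEMeasurable (quantile μ) (volume.restrict (Set.Ioc 0 1)) :=
  aemeasurable_restrict_of_monotoneOn measurableSet_Ioc (quantile_monotoneOn hs)

/-- Inverse transform sampling: the quantile function of a uniform variable has law `μ`. -/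
lemma map_quantile (hs : ∀ᵐ r ∂μ, r ∈ Set.Icc l u) :
    (volume.restrict (Set.Ioc (0 : ℝ) 1)).map (quantile μ) = μ := by
  have : IsProbabilityMeasure (volume.restrict (Set.Ioc (0 : ℝ) 1)) := ⟨by simp⟩
  refine Measure.ext_of_Iic _ _ fun x => ?_
  rw [Measure.map_apply_of_aemeasurable (aemeasurable_quantile hs) measurableSet_Iic,
    Measure.restrict_apply' measurableSet_Ioc, ← ofReal_cdf]
  have : quantile μ ⁻¹' Set.Iic x ∩ Set.Ioc 0 1 = Set.Ioc 0 (cdf μ x) := by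
    ext z
    simp only [Set.mem_inter_iff, Set.mem_preimage, Set.mem_Iic]
    constructor
    · rintro ⟨h, hz⟩
      exact ⟨hz.1, (quantile_le_iff hs hz).1 h⟩
    · rintro ⟨h0, h⟩
      have hz : z ∈ Set.Ioc (0 : ℝ) 1 := ⟨h0, h.trans (cdf_le_one μ x)⟩
      exact ⟨(quantile_le_iff hs hz).2 h, hz⟩
  rw [this]
  simp

lemma integral_comp_quantile (hs : ∀ᵐ r ∂μ, r ∈ Set.Icc l u) {h : ℝ → ℝ} (hm : Measurable h) :
    ∫ r, h r ∂μ = ∫ z in Set.Ioc (0 : ℝ) 1, h (quantile μ z) := by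
  conv_lhs => rw [← map_quantile hs]
  exact integral_map (aemeasurable_quantile hs) hm.aestronglyMeasurable

lemma measure_eq_volume_preimage (hs : ∀ᵐ r ∂μ, r ∈ Set.Icc l u) {s : Set ℝ}
    (hm : MeasurableSet s) : μ s = volume (quantile μ ⁻¹' s ∩ Set.Ioc 0 1) := by
  conv_lhs => rw [← map_quantile hs]
  rw [Measure.map_apply_of_aemeasurable (aemeasurable_quantile hs) hm,
    Measure.restrict_apply' measurableSet_Ioc]

lemma integrableOn_quantile (hs : ∀ᵐ r ∂μ, r ∈ Set.Icc l u) :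
    IntegrableOn (quantile μ) (Set.Ioc 0 1) := by
  refine Integrable.of_bound (aemeasurable_quantile hs).aestronglyMeasurable (max |l| |u|) ?_
  refine (ae_restrict_iff' measurableSet_Ioc).2 (Filter.Eventually.of_forall fun z hz => ?_)
  have := quantile_mem_Icc hs hz
  exact abs_le_max_abs_abs this.1 this.2

lemma intervalIntegrable_quantile (hs : ∀ᵐ r ∂μ, r ∈ Set.Icc l u) {x y : ℝ}
    (hx : x ∈ Set.Icc (0 : ℝ) 1) (hy : y ∈ Set.Icc (0 : ℝ) 1) :
    IntervalIntegrable (quantile μ) volume x y := by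
  rw [intervalIntegrable_iff]
  refine (integrableOn_quantile hs).mono_set ?_
  exact Set.Ioc_subset_Ioc (le_min hx.1 hy.1) (max_le hx.2 hy.2)

end Quantile

/-- The reward per query from serving exactly the best proportion `q` of queries with reward
law `μ`. -/
noncomputable def topReward (μ : Measure ℝ) (q : ℝ) : ℝ := ∫ z in (1 - q)..1, quantile μ z

section TopReward

variable {μ : Measure ℝ} [IsProbabilityMeasure μ] {l u : ℝ}

lemma topReward_zero (μ : Measure ℝ) : topReward μ 0 = 0 := by simp [topReward]

lemma topReward_sub (hs : ∀ᵐ r ∂μ, r ∈ Set.Icc l u) {x y : ℝ}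
    (hx : x ∈ Set.Icc (0 : ℝ) 1) (hy : y ∈ Set.Icc (0 : ℝ) 1) :
    topReward μ y - topReward μ x = ∫ z in (1 - y)..(1 - x), quantile μ z := by
  have h1 : (1 : ℝ) ∈ Set.Icc (0 : ℝ) 1 := by simp
  have hx' : 1 - x ∈ Set.Icc (0 : ℝ) 1 := ⟨by linarith [hx.2], by linarith [hx.1]⟩
  have hy' : 1 - y ∈ Set.Icc (0 : ℝ) 1 := ⟨by linarith [hy.2], by linarith [hy.1]⟩
  rw [topReward, topReward, sub_eq_iff_eq_add]
  exact (intervalIntegral.integral_add_adjacent_intervals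
    (intervalIntegrable_quantile hs hy' hx') (intervalIntegrable_quantile hs hx' h1)).symm

/-- The average slope of `topReward μ` on `[x, y]` is at least the quantile that belongs
to `y`. -/
lemma mul_quantile_le_topReward_sub (hs : ∀ᵐ r ∂μ, r ∈ Set.Icc l u) {x y : ℝ}
    (hx : 0 ≤ x) (hxy : x ≤ y) (hy : y < 1) :
    (y - x) * quantile μ (1 - y) ≤ topReward μ y - topReward μ x := by
  rw [topReward_sub hs ⟨hx, by linarith⟩ ⟨by linarith, hy.le⟩]
  have h := intervalIntegral.integral_mono_on (μ := volume) (a := 1 - y) (b := 1 - x)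
    (f := fun _ => quantile μ (1 - y)) (g := quantile μ) (by linarith) (by simp)
    (intervalIntegrable_quantile hs ⟨by linarith, by linarith⟩ ⟨by linarith, by linarith⟩)
    (fun z hz => quantile_monotoneOn hs ⟨by linarith, by linarith⟩
      ⟨by linarith [hz.1], by linarith [hz.2]⟩ hz.1)
  simpa using h

lemma topReward_sub_le_mul_quantile (hs : ∀ᵐ r ∂μ, r ∈ Set.Icc l u) {x y : ℝ}
    (hx : 0 ≤ x) (hxy : x ≤ y) (hy : y ≤ 1) (hx1 : x < 1) :
    topReward μ y - topReward μ x ≤ (y - x) * quantile μ (1 - x) := by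
  rw [topReward_sub hs ⟨hx, by linarith⟩ ⟨by linarith, hy⟩]
  have h := intervalIntegral.integral_mono_on_of_le_Ioo (μ := volume) (a := 1 - y) (b := 1 - x)
    (f := quantile μ) (g := fun _ => quantile μ (1 - x)) (by linarith)
    (intervalIntegrable_quantile hs ⟨by linarith, by linarith⟩ ⟨by linarith, by linarith⟩)
    (by simp)
    (fun z hz => quantile_monotoneOn hs ⟨by linarith [hz.1], by linarith [hz.2]⟩
      ⟨by linarith, by linarith⟩ hz.2.le)
  simpa using h

lemma topReward_sub_mem (hs : ∀ᵐ r ∂μ, r ∈ Set.Icc l u) {x y : ℝ}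
    (hx : 0 ≤ x) (hxy : x ≤ y) (hy : y ≤ 1) :
    topReward μ y - topReward μ x ∈ Set.Icc ((y - x) * l) ((y - x) * u) := by
  rw [topReward_sub hs ⟨hx, by linarith⟩ ⟨by linarith, hy⟩]
  have hi := intervalIntegrable_quantile (x := 1 - y) (y := 1 - x) hs
    ⟨by linarith, by linarith⟩ ⟨by linarith, by linarith⟩
  have hq : ∀ z ∈ Set.Ioo (1 - y) (1 - x), quantile μ z ∈ Set.Icc l u := fun z hz =>
    quantile_mem_Icc hs ⟨by linarith [hz.1], by linarith [hz.2]⟩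
  constructor
  · have h := intervalIntegral.integral_mono_on_of_le_Ioo (μ := volume) (a := 1 - y) (b := 1 - x)
      (f := fun _ => l) (g := quantile μ) (by linarith) (by simp) hi (fun z hz => (hq z hz).1)
    simpa using h
  · have h := intervalIntegral.integral_mono_on_of_le_Ioo (μ := volume) (a := 1 - y) (b := 1 - x)
      (f := quantile μ) (g := fun _ => u) (by linarith) hi (by simp) (fun z hz => (hq z hz).2)
    simpa using h

lemma topReward_mem (hs : ∀ᵐ r ∂μ, r ∈ Set.Icc l u) {q : ℝ} (hq : q ∈ Set.Icc (0 : ℝ) 1) :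
    topReward μ q ∈ Set.Icc (q * l) (q * u) := by
  simpa [topReward_zero] using topReward_sub_mem hs le_rfl hq.1 hq.2

lemma continuousOn_topReward (hs : ∀ᵐ r ∂μ, r ∈ Set.Icc l u) :
    ContinuousOn (topReward μ) (Set.Icc 0 1) := by
  have : LipschitzOnWith (Real.toNNReal (max |l| |u|)) (topReward μ) (Set.Icc 0 1) := by
    refine LipschitzOnWith.of_dist_le_mul fun x hx y hy => ?_
    rw [Real.coe_toNNReal _ (by positivity)]
    have key : ∀ x y : ℝ, 0 ≤ x → x ≤ y → y ≤ 1 →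
        |topReward μ y - topReward μ x| ≤ max |l| |u| * |y - x| := by
      intro x y h0 hxy h1
      have h := topReward_sub_mem hs h0 hxy h1
      refine (abs_le_max_abs_abs h.1 h.2).trans ?_
      rw [abs_mul, abs_mul, ← mul_max_of_nonneg _ _ (abs_nonneg _), mul_comm]
    rcases le_total x y with h | h
    · rw [dist_comm, dist_comm x]; exact key x y hx.1 h hy.2
    · exact key y x hy.1 h hx.2
  exact this.continuousOn

/-- The exchange inequality for the concave function `topReward μ`: moving reward mass from a
higher proportion to a lower one does not decrease the total. -/
lemma topReward_exchange (hs : ∀ᵐ r ∂μ, r ∈ Set.Icc l u) {x h v k w w' : ℝ} (hw : 0 < w)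
    (hx : 0 ≤ x) (hh : 0 ≤ h) (hk : 0 ≤ k) (hxv : x + h ≤ v) (hv : v + k ≤ 1)
    (hwh : w * h = w' * k) :
    w' * (topReward μ (v + k) - topReward μ v) ≤ w * (topReward μ (x + h) - topReward μ x) := by
  rcases hk.eq_or_lt with rfl | hk
  · have : h = 0 := by simpa [hw.ne'] using hwh
    simp [this]
  have hw' : 0 ≤ w' := by
    by_contra! hneg
    nlinarith
  have h1 := mul_quantile_le_topReward_sub hs (x := x) (y := x + h) hx (by linarith) (by linarith)
  have h2 := topReward_sub_le_mul_quantile hs (x := v) (y := v + k) (by linarith) (by linarith) hv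
    (by linarith)
  have h3 : quantile μ (1 - v) ≤ quantile μ (1 - (x + h)) :=
    quantile_monotoneOn hs ⟨by linarith, by linarith⟩ ⟨by linarith, by linarith⟩ (by linarith)
  calc _ ≤ w' * ((v + k - v) * quantile μ (1 - v)) := by gcongr
    _ = (w * h) * quantile μ (1 - v) := by rw [hwh]; ring
    _ ≤ (w * h) * quantile μ (1 - (x + h)) := by gcongr
    _ = w * ((x + h - x) * quantile μ (1 - (x + h))) := by ring
    _ ≤ _ := by gcongr

/-- A dual certificate for `topReward μ q`: a threshold price `θ`. -/
lemma exists_topReward_eq (hs : ∀ᵐ r ∂μ, r ∈ Set.Icc l u) {q : ℝ} (hq : q ∈ Set.Icc (0 : ℝ) 1) :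
    ∃ θ, topReward μ q = θ * q + ∫ r, max (r - θ) 0 ∂μ := by
  obtain ⟨θ, hlow, hhigh⟩ : ∃ θ, (∀ z ∈ Set.Ioc (0 : ℝ) 1, z ≤ 1 - q → quantile μ z ≤ θ) ∧
      (∀ z ∈ Set.Ioc (0 : ℝ) 1, 1 - q < z → θ ≤ quantile μ z) := by
    rcases hq.2.eq_or_lt with rfl | h1
    · exact ⟨l, fun z hz h => absurd hz.1 (by linarith), fun z hz _ => (quantile_mem_Icc hs hz).1⟩
    · have hmem : 1 - q ∈ Set.Ioc (0 : ℝ) 1 := ⟨by linarith, by linarith [hq.1]⟩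
      exact ⟨quantile μ (1 - q), fun z hz h => quantile_monotoneOn hs hz hmem h,
        fun z hz h => quantile_monotoneOn hs hmem hz h.le⟩
  refine ⟨θ, ?_⟩
  rw [integral_comp_quantile hs (h := fun r => max (r - θ) 0) (by fun_prop)]
  have hsub : Set.Ioc (1 - q) 1 ⊆ Set.Ioc (0 : ℝ) 1 :=
    Set.Ioc_subset_Ioc_left (by linarith [hq.2])
  have e1 : ∫ z in Set.Ioc (0 : ℝ) 1, max (quantile μ z - θ) 0
      = ∫ z in Set.Ioc (1 - q) 1, (quantile μ z - θ) := by
    rw [← integral_indicator measurableSet_Ioc, ← integral_indicator measurableSet_Ioc]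
    congr 1
    ext z
    by_cases hz : z ∈ Set.Ioc (0 : ℝ) 1
    · by_cases hz' : z ∈ Set.Ioc (1 - q) 1
      · simp only [hz, hz', Set.indicator_of_mem]
        exact max_eq_left (by linarith [hhigh z hz hz'.1])
      · have : z ≤ 1 - q := by
          by_contra! h
          exact hz' ⟨h, hz.2⟩
        simp only [hz, hz', Set.indicator_of_mem, not_false_eq_true, Set.indicator_of_notMem]
        exact max_eq_right (by linarith [hlow z hz this])
    · have hz' : z ∉ Set.Ioc (1 - q) 1 := fun h => hz (hsub h)
      simp [hz, hz']
  rw [e1, integral_sub ((integrableOn_quantile hs).mono_set hsub) (by simp), topReward,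
    intervalIntegral.integral_of_le (by linarith [hq.1])]
  simp [hq.1]
  ring

lemma topReward_one (hs : ∀ᵐ r ∂μ, r ∈ Set.Icc l u) : topReward μ 1 = ∫ r, r ∂μ := by
  rw [integral_comp_quantile hs (h := fun r => r) measurable_id, topReward,
    intervalIntegral.integral_of_le (by norm_num)]
  simp

end TopReward

/-! ### Reward laws with a density bounded below -/

section Density

variable {μ : Measure ℝ} [IsProbabilityMeasure μ] {l u α : ℝ}

lemma quantile_strictMonoOn (hs : ∀ᵐ r ∂μ, r ∈ Set.Icc l u) (h0 : ∀ x, μ {x} = 0) :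
    StrictMonoOn (quantile μ) (Set.Ioc 0 1) := by
  intro z hz w hw hzw
  refine (quantile_monotoneOn hs hz hw hzw.le).lt_of_ne fun heq => ?_
  have h1 := measure_eq_volume_preimage hs (measurableSet_singleton (quantile μ z))
  rw [h0] at h1
  have h2 : Set.Icc z w ⊆ quantile μ ⁻¹' {quantile μ z} ∩ Set.Ioc 0 1 := by
    intro y hy
    have hy' : y ∈ Set.Ioc (0 : ℝ) 1 := ⟨hz.1.trans_le hy.1, hy.2.trans hw.2⟩
    refine ⟨le_antisymm ?_ (quantile_monotoneOn hs hz hy' hy.1), hy'⟩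
    rw [heq]
    exact quantile_monotoneOn hs hy' hw hy.2
  have h3 := measure_mono (μ := volume) h2
  rw [← h1, Real.volume_Icc] at h3
  simp at h3
  linarith

lemma quantile_sub_le (hs : ∀ᵐ r ∂μ, r ∈ Set.Icc l u) (hα : 0 < α)
    (hd : ∀ x y, l ≤ x → x ≤ y → y ≤ u → ENNReal.ofReal (α * (y - x)) ≤ μ (Set.Ioo x y))
    {z w : ℝ} (hz : z ∈ Set.Ioc (0 : ℝ) 1) (hw : w ∈ Set.Ioc (0 : ℝ) 1) (hzw : z ≤ w) :
    quantile μ w - quantile μ z ≤ 1 / α * (w - z) := by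
  have h1 := hd _ _ (quantile_mem_Icc hs hz).1 (quantile_monotoneOn hs hz hw hzw)
    (quantile_mem_Icc hs hw).2
  rw [measure_eq_volume_preimage hs measurableSet_Ioo] at h1
  have h2 : quantile μ ⁻¹' Set.Ioo (quantile μ z) (quantile μ w) ∩ Set.Ioc 0 1 ⊆ Set.Ioc z w := by
    rintro y ⟨hy, hy'⟩
    constructor
    · by_contra! h
      exact absurd (quantile_monotoneOn hs hy' hz h) (not_le.2 hy.1)
    · by_contra! h
      exact absurd (quantile_monotoneOn hs hw hy' h.le) (not_le.2 hy.2)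
  have h3 := h1.trans (measure_mono (μ := volume) h2)
  rw [Real.volume_Ioc, ENNReal.ofReal_le_ofReal_iff (by linarith)] at h3
  rw [div_mul_eq_mul_div, one_mul, le_div_iff₀ hα]
  linarith

/-- For a law without atoms the threshold at the `(1 - q)`-quantile accepts a proportion `q`. -/
lemma integral_threshold (hs : ∀ᵐ r ∂μ, r ∈ Set.Icc l u) (h0 : ∀ x, μ {x} = 0) {q : ℝ}
    (hq : 0 ≤ q) (hq1 : q < 1) :
    ∫ r, (if quantile μ (1 - q) ≤ r then (1 : ℝ) else 0) ∂μ = q ∧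
    ∫ r, r * (if quantile μ (1 - q) ≤ r then (1 : ℝ) else 0) ∂μ = topReward μ q := by
  have hm : Measurable fun r : ℝ => if quantile μ (1 - q) ≤ r then (1 : ℝ) else 0 :=
    Measurable.ite measurableSet_Ici measurable_const measurable_const
  have hmem : 1 - q ∈ Set.Ioc (0 : ℝ) 1 := ⟨by linarith, by linarith⟩
  have hiff : ∀ z ∈ Set.Ioc (0 : ℝ) 1, (quantile μ (1 - q) ≤ quantile μ z ↔ 1 - q ≤ z) :=
    fun z hz => (quantile_strictMonoOn hs h0).le_iff_le hmem hz
  have key : ∀ g : ℝ → ℝ, ∫ z in Set.Ioc (0 : ℝ) 1,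
      g z * (if quantile μ (1 - q) ≤ quantile μ z then (1 : ℝ) else 0) =
      ∫ z in Set.Ioc (1 - q) 1, g z := by
    intro g
    rw [← integral_Icc_eq_integral_Ioc (x := 1 - q), ← integral_indicator measurableSet_Ioc,
      ← integral_indicator measurableSet_Icc]
    congr 1
    ext z
    by_cases hz : z ∈ Set.Ioc (0 : ℝ) 1
    · by_cases hz' : 1 - q ≤ z
      · have : z ∈ Set.Icc (1 - q) 1 := ⟨hz', hz.2⟩
        simp only [hz, this, Set.indicator_of_mem, if_pos ((hiff z hz).2 hz'), mul_one]
      · have : z ∉ Set.Icc (1 - q) 1 := fun h => hz' h.1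
        simp [hz, this, hiff z hz, hz']
    · have hz' : z ∉ Set.Icc (1 - q) 1 := fun h => hz ⟨hmem.1.trans_le h.1, h.2⟩
      simp [hz, hz']
  constructor
  · rw [integral_comp_quantile hs hm]
    simpa [hq] using key fun _ => 1
  · rw [integral_comp_quantile hs (h := fun r => r * if quantile μ (1 - q) ≤ r then (1 : ℝ) else 0)
      (measurable_id.mul hm), key, topReward, intervalIntegral.integral_of_le (by linarith)]

/-- If the density is at least `α`, then `topReward μ` has a slope at every `q` (a one-sided one at
the end points), and the error of the first order expansion is at most quadratic. -/
lemma exists_slope (hs : ∀ᵐ r ∂μ, r ∈ Set.Icc l u) (hα : 0 < α)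
    (hd : ∀ x y, l ≤ x → x ≤ y → y ≤ u → ENNReal.ofReal (α * (y - x)) ≤ μ (Set.Ioo x y))
    {q : ℝ} (hq : q ∈ Set.Icc (0 : ℝ) 1) :
    ∃ g : ℝ, ∀ q' ∈ Set.Icc (0 : ℝ) 1,
      topReward μ q + g * (q' - q) - 1 / α * (q' - q) ^ 2 ≤ topReward μ q' := by
  -- `quantile μ 0` is a junk value, so the slope at `q = 1` is the limit `g` of `quantile μ` at `0`
  obtain ⟨g, hg⟩ : ∃ g : ℝ, ∀ z ∈ Set.Ioc (0 : ℝ) 1,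
      |quantile μ z - g| ≤ 1 / α * |z - (1 - q)| := by
    rcases hq.2.eq_or_lt with rfl | h1
    · refine ⟨sInf (quantile μ '' Set.Ioc 0 1), fun z hz => ?_⟩
      have hbdd : BddBelow (quantile μ '' Set.Ioc 0 1) :=
        ⟨l, by rintro _ ⟨w, hw, rfl⟩; exact (quantile_mem_Icc hs hw).1⟩
      have h1 : sInf (quantile μ '' Set.Ioc 0 1) ≤ quantile μ z := csInf_le hbdd ⟨z, hz, rfl⟩
      have h2 : quantile μ z - 1 / α * z ≤ sInf (quantile μ '' Set.Ioc 0 1) := by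
        refine le_csInf ⟨_, z, hz, rfl⟩ ?_
        rintro _ ⟨w, hw, rfl⟩
        have hpos : 0 < 1 / α := by positivity
        rcases le_total w z with h | h
        · have := quantile_sub_le hs hα hd hw hz h
          nlinarith [hw.1]
        · have := quantile_monotoneOn hs hz hw h
          nlinarith [hz.1]
      rw [abs_of_nonneg (by linarith), sub_self, sub_zero, abs_of_pos hz.1]
      linarith
    · have hmem : 1 - q ∈ Set.Ioc (0 : ℝ) 1 := ⟨by linarith, by linarith [hq.1]⟩
      refine ⟨quantile μ (1 - q), fun z hz => ?_⟩
      rcases le_total z (1 - q) with h | h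
      · rw [abs_sub_comm, abs_of_nonneg (sub_nonneg.2 (quantile_monotoneOn hs hz hmem h)),
          abs_sub_comm, abs_of_nonneg (by linarith)]
        exact quantile_sub_le hs hα hd hz hmem h
      · rw [abs_of_nonneg (sub_nonneg.2 (quantile_monotoneOn hs hmem hz h)),
          abs_of_nonneg (by linarith)]
        exact quantile_sub_le hs hα hd hmem hz h
  refine ⟨g, fun q' hq' => ?_⟩
  have h1 := topReward_sub hs hq hq'
  have hi : IntervalIntegrable (quantile μ) volume (1 - q') (1 - q) :=
    intervalIntegrable_quantile hs ⟨by linarith [hq'.2], by linarith [hq'.1]⟩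
      ⟨by linarith [hq.2], by linarith [hq.1]⟩
  have h2 : ‖∫ z in (1 - q')..(1 - q), (quantile μ z - g)‖ ≤
      (1 / α * |q' - q|) * |(1 - q) - (1 - q')| := by
    refine intervalIntegral.norm_integral_le_of_norm_le_const fun z hz => ?_
    have hz' : z ∈ Set.Ioc (0 : ℝ) 1 := by
      have := Set.uIoc_subset_uIcc hz
      constructor
      · refine lt_of_le_of_lt ?_ hz.1
        exact le_min (by linarith [hq'.2]) (by linarith [hq.2])
      · refine hz.2.trans ?_
        exact max_le (by linarith [hq'.1]) (by linarith [hq.1])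
    refine (hg z hz').trans ?_
    gcongr 1 / α * ?_
    have hz2 : z ∈ Set.uIcc (1 - q) (1 - q') := by
      rw [Set.uIcc_comm]; exact Set.uIoc_subset_uIcc hz
    have := Set.abs_sub_left_of_mem_uIcc hz2
    calc |z - (1 - q)| ≤ |(1 - q') - (1 - q)| := this
      _ = |q' - q| := by rw [abs_sub_comm]; congr 1; ring
  rw [intervalIntegral.integral_sub hi (by simp), ← h1, Real.norm_eq_abs] at h2
  have h3 : (1 / α * |q' - q|) * |(1 - q) - (1 - q')| = 1 / α * (q' - q) ^ 2 := by
    rw [show (1 - q) - (1 - q') = q' - q by ring, mul_assoc, ← abs_mul, ← sq, abs_sq]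
  rw [h3] at h2
  have h4 := (abs_le.1 h2).1
  simp only [intervalIntegral.integral_const, smul_eq_mul] at h4
  linarith

end Density

lemma withDensity_props {μ : Measure ℝ} {l u α : ℝ} (f : ℝ → ENNReal) (hf : Measurable f)
    (hfα : ∀ r ∈ Set.Icc l u, ENNReal.ofReal α ≤ f r)
    (hμ : μ = (volume.restrict (Set.Icc l u)).withDensity f) :
    (∀ᵐ r ∂μ, r ∈ Set.Icc l u) ∧ (∀ x, μ {x} = 0) ∧
    ∀ x y, l ≤ x → x ≤ y → y ≤ u → ENNReal.ofReal (α * (y - x)) ≤ μ (Set.Ioo x y) := by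
  have hac : μ ≪ volume.restrict (Set.Icc l u) := hμ ▸ withDensity_absolutelyContinuous _ _
  refine ⟨hac.ae_le (ae_restrict_mem measurableSet_Icc), fun x => hac (by simp), ?_⟩
  intro x y hx hxy hy
  rw [hμ, withDensity_apply _ measurableSet_Ioo, Measure.restrict_restrict measurableSet_Ioo,
    Set.inter_eq_left.2 (Set.Ioo_subset_Icc_self.trans (Set.Icc_subset_Icc hx hy))]
  calc ENNReal.ofReal (α * (y - x)) = ∫⁻ _ in Set.Ioo x y, ENNReal.ofReal α := by
        rw [setLIntegral_const, Real.volume_Ioo, ENNReal.ofReal_mul' (by linarith)]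
    _ ≤ _ := setLIntegral_mono hf fun r hr => hfα r ⟨hx.trans hr.1.le, hr.2.le.trans hy⟩

section Rewards

variable {n : ℕ} {R : Rewards n} {α : ℝ}

lemma Rewards.DensityBoundedBelow.isProb (hR : R.DensityBoundedBelow α) (j : Fin n) :
    IsProbabilityMeasure (R.F j) := (hR j).2.1

lemma Rewards.DensityBoundedBelow.ae_mem (hR : R.DensityBoundedBelow α) (j : Fin n) :
    ∀ᵐ r ∂(R.F j), r ∈ Set.Icc (R.l j) (R.u j) := by
  have := hR.isProb j
  rcases (hR j).2.2 with ⟨-, f, hf, hfα, hF⟩ | ⟨hlu, hF⟩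
  · exact (withDensity_props f hf hfα hF).1
  · rw [hF]
    exact (ae_dirac_iff measurableSet_Icc).2 ⟨le_rfl, hlu.le⟩

lemma Rewards.DensityBoundedBelow.l_le_u (hR : R.DensityBoundedBelow α) (j : Fin n) :
    R.l j ≤ R.u j := by
  rcases (hR j).2.2 with ⟨h, -⟩ | ⟨h, -⟩
  exacts [h.le, h.le]

lemma Rewards.DensityBoundedBelow.u_nonneg (hR : R.DensityBoundedBelow α) (j : Fin n) :
    0 ≤ R.u j := (hR j).1.trans (hR.l_le_u j)

lemma topReward_dirac {l q : ℝ} (hq : q ∈ Set.Icc (0 : ℝ) 1) :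
    topReward (Measure.dirac l) q = l * q := by
  have h := topReward_mem (μ := Measure.dirac l) (l := l) (u := l)
    ((ae_dirac_iff measurableSet_Icc).2 (by simp)) hq
  linarith [h.1, h.2]

/-- Every proportion can be accepted optimally by some randomized acceptance rule. -/
lemma exists_acceptance (hR : R.DensityBoundedBelow α) (j : Fin n) {q : ℝ}
    (hq : q ∈ Set.Icc (0 : ℝ) 1) :
    ∃ x : ℝ → ℝ, Measurable x ∧ (∀ r, x r ∈ Set.Icc (0 : ℝ) 1) ∧ ∫ r, x r ∂(R.F j) = q ∧
      ∫ r, r * x r ∂(R.F j) = topReward (R.F j) q := by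
  have := hR.isProb j
  have hs := hR.ae_mem j
  rcases hq.2.eq_or_lt with rfl | h1
  · exact ⟨fun _ => 1, measurable_const, by simp, by simp, by simpa using (topReward_one hs).symm⟩
  rcases (hR j).2.2 with ⟨-, f, hf, hfα, hF⟩ | ⟨hlu, hF⟩
  · have h := integral_threshold hs (withDensity_props f hf hfα hF).2.1 hq.1 h1
    refine ⟨_, Measurable.ite measurableSet_Ici measurable_const measurable_const, ?_, h⟩
    intro r
    split_ifs <;> simp
  · refine ⟨fun _ => q, measurable_const, fun _ => hq, by simp, ?_⟩
    rw [hF, topReward_dirac hq]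
    simp

end Rewards

/-! ### The semi-fluid relaxation in terms of acceptance proportions -/

section SemiFluid

variable {m n : ℕ} {a : Fin n → Fin m → ℝ} {R : Rewards n} {α : ℝ}

lemma proportionReward_eq (w q : Fin n → ℝ) :
    proportionReward R w q = ∑ j, w j * topReward (R.F j) (q j) := rfl

/-- Weak duality for a single query: whatever acceptance rule `x` is used, possibly one that looks
at more than the reward `ρ`, it earns no more than the price `θ` of what it uses plus the
expected surplus over `θ`. -/
lemma integral_mul_le_price {Ω : Type*} [MeasurableSpace Ω] {P : Measure Ω} [IsProbabilityMeasure P]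
    {ρ x : Ω → ℝ} {l u : ℝ} (hρ : Measurable ρ) (hx : Measurable x)
    (hs : ∀ᵐ ω ∂P, ρ ω ∈ Set.Icc l u) (hx01 : ∀ ω, x ω ∈ Set.Icc (0 : ℝ) 1) (θ : ℝ) :
    ∫ ω, ρ ω * x ω ∂P ≤ θ * ∫ ω, x ω ∂P + ∫ ω, max (ρ ω - θ) 0 ∂P := by
  have hb : ∀ᵐ ω ∂P, ‖ρ ω‖ ≤ max |l| |u| := hs.mono fun ω h => abs_le_max_abs_abs h.1 h.2
  have hiρ : Integrable ρ P := Integrable.of_bound hρ.aestronglyMeasurable _ hb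
  have hix : Integrable x P := Integrable.of_bound hx.aestronglyMeasurable 1
    (Filter.Eventually.of_forall fun ω => by
      rw [Real.norm_eq_abs, abs_of_nonneg (hx01 ω).1]; exact (hx01 ω).2)
  have hiρx : Integrable (fun ω => ρ ω * x ω) P :=
    Integrable.of_bound (hρ.mul hx).aestronglyMeasurable (max |l| |u|) (hb.mono fun ω h => by
      rw [norm_mul, Real.norm_eq_abs (x ω), abs_of_nonneg (hx01 ω).1]
      exact (mul_le_of_le_one_right (norm_nonneg _) (hx01 ω).2).trans h)
  have him : Integrable (fun ω => max (ρ ω - θ) 0) P := (hiρ.sub (integrable_const θ)).pos_part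
  rw [← integral_const_mul, ← integral_add (hix.const_mul θ) him]
  refine integral_mono hiρx ((hix.const_mul θ).add him) fun ω => ?_
  have h1 := hx01 ω
  have h2 : (ρ ω - θ) * x ω ≤ max (ρ ω - θ) 0 := by
    rcases le_total (ρ ω - θ) 0 with h | h
    · rw [max_eq_right h]; exact mul_nonpos_of_nonpos_of_nonneg h h1.1
    · rw [max_eq_left h]; exact mul_le_of_le_one_right h h1.2
  simp only
  linarith

lemma integral_mul_le_topReward (hR : R.DensityBoundedBelow α) (j : Fin n) {x : ℝ → ℝ}
    (hx : Measurable x) (hx01 : ∀ r, x r ∈ Set.Icc (0 : ℝ) 1) :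
    (∫ r, x r ∂(R.F j)) ∈ Set.Icc (0 : ℝ) 1 ∧
    ∫ r, r * x r ∂(R.F j) ≤ topReward (R.F j) (∫ r, x r ∂(R.F j)) := by
  have := hR.isProb j
  have hix : Integrable x (R.F j) := Integrable.of_bound hx.aestronglyMeasurable 1
    (Filter.Eventually.of_forall fun ω => by
      rw [Real.norm_eq_abs, abs_of_nonneg (hx01 ω).1]; exact (hx01 ω).2)
  have hmem : (∫ r, x r ∂(R.F j)) ∈ Set.Icc (0 : ℝ) 1 := by
    refine ⟨integral_nonneg fun r => (hx01 r).1, ?_⟩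
    simpa using integral_mono hix (integrable_const (1 : ℝ)) fun r => (hx01 r).2
  refine ⟨hmem, ?_⟩
  obtain ⟨θ, hθ⟩ := exists_topReward_eq (hR.ae_mem j) hmem
  rw [hθ]
  exact integral_mul_le_price measurable_id hx (hR.ae_mem j) hx01 θ

lemma semiFluid_le_of_forall (c : Fin m → ℝ) (hc : ∀ i, 0 ≤ c i) (hR : R.DensityBoundedBelow α)
    (d : Fin n → ℕ) {B : ℝ}
    (hB : ∀ q, IsFeasibleProportion a (fun j => (d j : ℝ)) c q →
      proportionReward R (fun j => (d j : ℝ)) q ≤ B) :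
    semiFluid a R c d ≤ B := by
  refine csSup_le ⟨0, fun _ _ => 0, by simp, by simp, by simpa using hc, by simp⟩ ?_
  rintro v ⟨x, hxm, hx01, hfeas, rfl⟩
  refine le_trans ?_ (hB (fun j => ∫ r, x j r ∂(R.F j))
    ⟨fun j => (integral_mul_le_topReward hR j (hxm j) (hx01 j)).1, hfeas⟩)
  refine Finset.sum_le_sum fun j _ => ?_
  exact mul_le_mul_of_nonneg_left (integral_mul_le_topReward hR j (hxm j) (hx01 j)).2
    (Nat.cast_nonneg _)

lemma semiFluid_le_of_optimal {c : Fin m → ℝ} (hc : ∀ i, 0 ≤ c i) (hR : R.DensityBoundedBelow α)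
    {d : Fin n → ℕ} {q : Fin n → ℝ} (hq : IsOptimalProportion a R (fun j => (d j : ℝ)) c q) :
    semiFluid a R c d ≤ proportionReward R (fun j => (d j : ℝ)) q :=
  semiFluid_le_of_forall c hc hR d hq.2

lemma topReward_le_of_le (hR : R.DensityBoundedBelow α) {U : ℝ} (hU : ∀ j, R.u j ≤ U) (j : Fin n)
    {q : ℝ} (hq : q ∈ Set.Icc (0 : ℝ) 1) : topReward (R.F j) q ≤ U := by
  have := hR.isProb j
  calc topReward (R.F j) q ≤ q * R.u j := (topReward_mem (hR.ae_mem j) hq).2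
    _ ≤ R.u j := mul_le_of_le_one_left (hR.u_nonneg j) hq.2
    _ ≤ U := hU j

lemma semiFluid_le_mul {c : Fin m → ℝ} (hc : ∀ i, 0 ≤ c i) (hR : R.DensityBoundedBelow α)
    {U : ℝ} (hU : ∀ j, R.u j ≤ U) (d : Fin n → ℕ) : semiFluid a R c d ≤ (∑ j, d j : ℕ) * U := by
  refine semiFluid_le_of_forall c hc hR d fun q hq => ?_
  rw [proportionReward_eq, Nat.cast_sum, Finset.sum_mul]
  exact Finset.sum_le_sum fun j _ => mul_le_mul_of_nonneg_left
    (topReward_le_of_le hR hU j (hq.1 j)) (Nat.cast_nonneg _)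

lemma le_semiFluid {c : Fin m → ℝ} (hR : R.DensityBoundedBelow α) {d : Fin n → ℕ}
    {q : Fin n → ℝ} (hq : IsFeasibleProportion a (fun j => (d j : ℝ)) c q) :
    proportionReward R (fun j => (d j : ℝ)) q ≤ semiFluid a R c d := by
  have hU : ∀ j, R.u j ≤ ∑ k, R.u k := fun j =>
    Finset.single_le_sum (f := R.u) (fun k _ => hR.u_nonneg k) (Finset.mem_univ j)
  choose x hxm hx01 hxq hxr using fun j => exists_acceptance hR j (hq.1 j)
  refine le_csSup ⟨∑ j, (d j : ℝ) * ∑ k, R.u k, ?_⟩ ⟨x, hxm, hx01, ?_, ?_⟩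
  · rintro v ⟨y, hym, hy01, -, rfl⟩
    refine Finset.sum_le_sum fun j _ => mul_le_mul_of_nonneg_left ?_ (Nat.cast_nonneg _)
    have := integral_mul_le_topReward hR j (hym j) (hy01 j)
    exact this.2.trans (topReward_le_of_le hR hU j this.1)
  · simpa only [hxq] using hq.2
  · simp only [hxr, proportionReward_eq]

lemma semiFluid_nonneg {c : Fin m → ℝ} (hc : ∀ i, 0 ≤ c i) (hR : R.DensityBoundedBelow α)
    (d : Fin n → ℕ) : 0 ≤ semiFluid a R c d := by
  have h := le_semiFluid (a := a) (c := c) (d := d) (q := fun _ => 0) hR ⟨by simp, by simpa using hc⟩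
  simpa [proportionReward_eq, topReward_zero] using h

end SemiFluid

/-! ### Optimal acceptance proportions -/

section Optimal

variable {m n : ℕ} {a : Fin n → Fin m → ℝ} {R : Rewards n} {α : ℝ}

/-- Among the optimal proportions there is one that is closest in `ℓ¹` to a given point. -/
lemma exists_closest_optimal (hR : R.DensityBoundedBelow α) (w : Fin n → ℝ) {c : Fin m → ℝ}
    (hc : ∀ i, 0 ≤ c i) (x : Fin n → ℝ) :
    ∃ z, IsOptimalProportion a R w c z ∧ ∀ z', IsOptimalProportion a R w c z' →
      ∑ j, |z j - x j| ≤ ∑ j, |z' j - x j| := by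
  set S : Set (Fin n → ℝ) := {q | IsFeasibleProportion a w c q} with hS
  have hSsub : S ⊆ Set.Icc 0 1 := fun q hq => ⟨fun j => (hq.1 j).1, fun j => (hq.1 j).2⟩
  have hclosed : IsClosed S := by
    have h1 : S = Set.Icc 0 1 ∩ ⋂ i, {q | ∑ j, w j * a j i * q j ≤ c i} := by
      ext q
      simp only [hS, IsFeasibleProportion, Set.mem_inter_iff, Set.mem_iInter]
      refine and_congr ⟨fun h => ⟨fun j => (h j).1, fun j => (h j).2⟩,
        fun h j => ⟨h.1 j, h.2 j⟩⟩ Iff.rfl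
    rw [h1]
    exact isClosed_Icc.inter (isClosed_iInter fun i => isClosed_le (by fun_prop) (by fun_prop))
  have hcompact : IsCompact S := isCompact_Icc.of_isClosed_subset hclosed hSsub
  have hcont : ContinuousOn (proportionReward R w) S := by
    refine continuousOn_finsetSum _ fun j _ => continuousOn_const.mul ?_
    have := hR.isProb j
    exact (continuousOn_topReward (hR.ae_mem j)).comp (continuous_apply j).continuousOn
      fun q hq => hq.1 j
  have hne : S.Nonempty := ⟨0, by simp, by simpa using hc⟩
  obtain ⟨z₀, hz₀, hmax⟩ := hcompact.exists_isMaxOn hne hcont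
  have hcompact' : IsCompact (S ∩ proportionReward R w ⁻¹' Set.Ici (proportionReward R w z₀)) :=
    hcompact.of_isClosed_subset (hcont.preimage_isClosed_of_isClosed hclosed isClosed_Ici)
      Set.inter_subset_left
  obtain ⟨z, hz, hmin⟩ := hcompact'.exists_isMinOn (f := fun z => ∑ j, |z j - x j|)
    ⟨z₀, hz₀, le_refl (proportionReward R w z₀)⟩ (by fun_prop)
  refine ⟨z, ⟨hz.1, fun q hq => (hmax hq).trans hz.2⟩, fun z' hz' => ?_⟩
  exact hmin ⟨hz'.1, hz'.2 z₀ hz₀⟩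

end Optimal

/-! ### Sensitivity of optimal proportions -/

section Sensitivity

/-- A positively homogeneous function that is positive on a closed cone away from the apex
dominates a multiple of the norm there. -/
lemma exists_norm_le_mul_of_pos {E : Type*} [NormedAddCommGroup E] [NormedSpace ℝ E]
    [FiniteDimensional ℝ E] {K : Set E} (hK : IsClosed K)
    (hKs : ∀ t : ℝ, 0 < t → ∀ x ∈ K, t • x ∈ K) {v : E → ℝ} (hv : Continuous v)
    (hvs : ∀ t : ℝ, 0 < t → ∀ x, v (t • x) = t * v x) (hpos : ∀ x ∈ K, x ≠ 0 → 0 < v x) :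
    ∃ κ : ℝ, 0 ≤ κ ∧ ∀ x ∈ K, ‖x‖ ≤ κ * v x := by
  have hv0 : v 0 = 0 := by
    have := hvs 2 two_pos 0
    rw [smul_zero] at this
    linarith
  have hcompact : IsCompact (K ∩ Metric.sphere 0 1) :=
    (isCompact_sphere (0 : E) 1).inter_left hK
  have hscale : ∀ x ∈ K, x ≠ 0 → ‖x‖⁻¹ • x ∈ K ∩ Metric.sphere 0 1 := fun x hx h0 =>
    ⟨hKs _ (by positivity) x hx, by simp [norm_smul, h0]⟩
  rcases (K ∩ Metric.sphere 0 1).eq_empty_or_nonempty with he | hne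
  · refine ⟨0, le_rfl, fun x hx => ?_⟩
    rcases eq_or_ne x 0 with rfl | h0
    · simp
    · exact absurd (hscale x hx h0) (he ▸ Set.notMem_empty _)
  · obtain ⟨x₀, hx₀, hmin⟩ := hcompact.exists_isMinOn hne hv.continuousOn
    have hv₀ : 0 < v x₀ := hpos x₀ hx₀.1 (by rintro rfl; simpa using hx₀.2)
    refine ⟨(v x₀)⁻¹, by positivity, fun x hx => ?_⟩
    rcases eq_or_ne x 0 with rfl | h0
    · simp [hv0]
    · have h1 : v x₀ ≤ v (‖x‖⁻¹ • x) := hmin (hscale x hx h0)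
      have hn : 0 < ‖x‖ := norm_pos_iff.2 h0
      rw [hvs _ (by positivity), le_inv_mul_iff₀ hn] at h1
      rw [le_inv_mul_iff₀ hv₀]
      linarith

lemma eventually_mul_le {k e : ℝ} (h : 0 < e ∨ k ≤ 0 ∧ 0 ≤ e) :
    ∀ᶠ t in nhdsWithin (0 : ℝ) (Set.Ioi 0), t * k ≤ e := by
  rcases h with h | ⟨hk, he⟩
  · have : Filter.Tendsto (fun t : ℝ => t * k) (nhdsWithin 0 (Set.Ioi 0)) (nhds (0 * k)) :=
      ((continuous_id.mul continuous_const).tendsto 0).mono_left nhdsWithin_le_nhds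
    rw [zero_mul] at this
    exact (this.eventually_lt_const h).mono fun t ht => ht.le
  · filter_upwards [self_mem_nhdsWithin] with t ht
    exact (mul_nonpos_of_nonneg_of_nonpos (le_of_lt ht) hk).trans he

variable {m n : ℕ} {a : Fin n → Fin m → ℝ} {R : Rewards n} {α : ℝ}

/-- Vectors whose coordinates have the signs `σ`, or vanish. -/
def signCone (σ : Fin n → SignType) : Set (Fin n → ℝ) :=
  {η | ∀ j, 0 ≤ (σ j : ℝ) * η j ∧ (σ j = 0 → η j = 0)}

/-- The total violation by `η` of the inequalities `∑ j, a j i * η j ≤ 0` for `i ∈ I` and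
`0 ≤ ∑ j, a j i * η j` for `i ∈ I'`. -/
noncomputable def rowViolation (a : Fin n → Fin m → ℝ) (I I' : Finset (Fin m)) (η : Fin n → ℝ) : ℝ :=
  ∑ i ∈ I, max (∑ j, a j i * η j) 0 + ∑ i ∈ I', max (-∑ j, a j i * η j) 0

/-- A Hoffman type bound with a constant that serves all sign patterns and sets of rows at once. -/
lemma exists_uniform_bound (a : Fin n → Fin m → ℝ) :
    ∃ κ : ℝ, 0 ≤ κ ∧ ∀ (σ : Fin n → SignType) (I I' : Finset (Fin m)),
      (∀ η ∈ signCone σ, (∀ i ∈ I, ∑ j, a j i * η j ≤ 0) → (∀ i ∈ I', 0 ≤ ∑ j, a j i * η j) →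
        η = 0) →
      ∀ η ∈ signCone σ, ‖η‖ ≤ κ * rowViolation a I I' η := by
  have hnonneg : ∀ I I' η, 0 ≤ rowViolation a I I' η := fun I I' η =>
    add_nonneg (Finset.sum_nonneg fun i _ => le_max_right _ _)
      (Finset.sum_nonneg fun i _ => le_max_right _ _)
  have key : ∀ P : (Fin n → SignType) × Finset (Fin m) × Finset (Fin m), ∃ κ : ℝ, 0 ≤ κ ∧
      ((∀ η ∈ signCone P.1, (∀ i ∈ P.2.1, ∑ j, a j i * η j ≤ 0) →
        (∀ i ∈ P.2.2, 0 ≤ ∑ j, a j i * η j) → η = 0) →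
      ∀ η ∈ signCone P.1, ‖η‖ ≤ κ * rowViolation a P.2.1 P.2.2 η) := by
    rintro ⟨σ, I, I'⟩
    by_cases h : ∀ η ∈ signCone σ, (∀ i ∈ I, ∑ j, a j i * η j ≤ 0) →
        (∀ i ∈ I', 0 ≤ ∑ j, a j i * η j) → η = 0
    swap
    · exact ⟨0, le_rfl, fun h' => absurd h' h⟩
    have hclosed : IsClosed (signCone σ) := by
      have : signCone σ = ⋂ j, ({η : Fin n → ℝ | 0 ≤ (σ j : ℝ) * η j} ∩
          {η : Fin n → ℝ | σ j = 0 → η j = 0}) := by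
        ext η; simp [signCone]
      rw [this]
      refine isClosed_iInter fun j => (isClosed_le (by fun_prop) (by fun_prop)).inter ?_
      by_cases hj : σ j = 0
      · simpa [hj] using isClosed_eq (continuous_apply j) continuous_const
      · simp [hj]
    obtain ⟨κ, h0, hκ⟩ := exists_norm_le_mul_of_pos hclosed
      (fun t ht η hη j => ⟨by
        have := mul_nonneg ht.le (hη j).1
        simp only [Pi.smul_apply, smul_eq_mul]; linarith,
        fun hj => by simp [(hη j).2 hj]⟩) (v := rowViolation a I I')
      (by unfold rowViolation; fun_prop)
      (fun t ht η => by
        have h1 : ∀ i, ∑ j, a j i * (t • η) j = t * ∑ j, a j i * η j := fun i => by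
          rw [Finset.mul_sum]
          exact Finset.sum_congr rfl fun j _ => by simp only [Pi.smul_apply, smul_eq_mul]; ring
        have h2 : ∀ y : ℝ, max (t * y) 0 = t * max y 0 := fun y => by
          rw [mul_max_of_nonneg _ _ ht.le, mul_zero]
        simp only [rowViolation, h1, ← mul_neg, h2, ← Finset.mul_sum, mul_add])
      (fun η hη hne => by
        refine (hnonneg I I' η).lt_of_ne fun h0 => hne (h η hη ?_ ?_)
        · have h1 := (add_eq_zero_iff_of_nonneg (Finset.sum_nonneg fun i _ => le_max_right _ _)
            (Finset.sum_nonneg fun i _ => le_max_right _ _)).1 h0.symm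
          intro i hi
          have := (Finset.sum_eq_zero_iff_of_nonneg fun i _ => le_max_right _ _).1 h1.1 i hi
          exact (le_max_left _ _).trans this.le
        · have h1 := (add_eq_zero_iff_of_nonneg (Finset.sum_nonneg fun i _ => le_max_right _ _)
            (Finset.sum_nonneg fun i _ => le_max_right _ _)).1 h0.symm
          intro i hi
          have := (Finset.sum_eq_zero_iff_of_nonneg fun i _ => le_max_right _ _).1 h1.2 i hi
          have := (le_max_left _ _).trans this.le
          linarith)
    exact ⟨κ, h0, fun _ => hκ⟩
  choose κ h0 hκ using key
  refine ⟨∑ P, κ P, Finset.sum_nonneg fun P _ => h0 P, fun σ I I' h η hη => ?_⟩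
  refine (hκ (σ, I, I') h η hη).trans (mul_le_mul_of_nonneg_right ?_ (hnonneg _ _ _))
  exact Finset.single_le_sum (f := κ) (fun P _ => h0 P) (Finset.mem_univ _)

/-- The exchange argument. Let `x` be optimal for the weights `w` and let `z` be the closest
optimal solution for the weights `w'`. A direction that has the signs of `z - x`, and along which
`x` may move forwards and `z` backwards, vanishes: concavity would make the exchanged point for `w'`
optimal too, and it would be closer to `x`. -/
lemma eq_zero_of_exchange (hR : R.DensityBoundedBelow α) {w w' : Fin n → ℝ} (hw : ∀ j, 0 < w j)
    (hw' : ∀ j, 0 < w' j) {c : Fin m → ℝ} {x z : Fin n → ℝ} (hx : IsOptimalProportion a R w c x)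
    (hz : IsOptimalProportion a R w' c z)
    (hclose : ∀ z', IsOptimalProportion a R w' c z' → ∑ j, |z j - x j| ≤ ∑ j, |z' j - x j|)
    {η : Fin n → ℝ} (hη : η ∈ signCone fun j => SignType.sign (z j - x j))
    (hI : ∀ i, ∑ j, w j * a j i * x j = c i → ∑ j, a j i * η j ≤ 0)
    (hI' : ∀ i, ∑ j, w' j * a j i * z j = c i → 0 ≤ ∑ j, a j i * η j) : η = 0 := by
  by_contra hne
  -- a small step length
  have h1 : ∀ᶠ t in nhdsWithin (0 : ℝ) (Set.Ioi 0), ∀ j,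
      t * (|η j| / w j + |η j| / w' j) ≤ |z j - x j| := by
    refine Filter.eventually_all.2 fun j => eventually_mul_le ?_
    by_cases hj : z j - x j = 0
    · have := (hη j).2 (by simp [hj])
      exact Or.inr ⟨by simp [this], abs_nonneg _⟩
    · exact Or.inl (abs_pos.2 hj)
  have h2 : ∀ᶠ t in nhdsWithin (0 : ℝ) (Set.Ioi 0), ∀ i,
      t * (∑ j, a j i * η j) ≤ c i - ∑ j, w j * a j i * x j := by
    refine Filter.eventually_all.2 fun i => eventually_mul_le ?_
    rcases (hx.1.2 i).eq_or_lt with h | h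
    · exact Or.inr ⟨hI i h, by linarith⟩
    · exact Or.inl (by linarith)
  have h3 : ∀ᶠ t in nhdsWithin (0 : ℝ) (Set.Ioi 0), ∀ i,
      t * (-∑ j, a j i * η j) ≤ c i - ∑ j, w' j * a j i * z j := by
    refine Filter.eventually_all.2 fun i => eventually_mul_le ?_
    rcases (hz.1.2 i).eq_or_lt with h | h
    · exact Or.inr ⟨by linarith [hI' i h], by linarith⟩
    · exact Or.inl (by linarith)
  obtain ⟨t, ht1, ht2, ht3, ht0⟩ := (h1.and (h2.and (h3.and self_mem_nhdsWithin))).exists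
  have ht0 : 0 < t := ht0
  -- coordinatewise facts: the moved points stay in between `x` and `z` and do not cross
  have hcoord : ∀ j, x j + t * η j / w j ∈ Set.Icc (0 : ℝ) 1 ∧
      z j - t * η j / w' j ∈ Set.Icc (0 : ℝ) 1 ∧
      |z j - t * η j / w' j - x j| = |z j - x j| - t * |η j| / w' j ∧
      w' j * (topReward (R.F j) (z j) - topReward (R.F j) (z j - t * η j / w' j)) ≤
        w j * (topReward (R.F j) (x j + t * η j / w j) - topReward (R.F j) (x j)) := by
    intro j
    have := hR.isProb j
    have hs := hR.ae_mem j
    have hwj := hw j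
    have hwj' := hw' j
    obtain ⟨hx0, hx1⟩ := hx.1.1 j
    obtain ⟨hz0, hz1⟩ := hz.1.1 j
    have hstep := ht1 j
    obtain ⟨hsign, hzero⟩ := hη j
    rcases lt_trichotomy (z j - x j) 0 with hlt | heq | hgt
    · have hη0 : η j ≤ 0 := by simpa [sign_neg hlt] using hsign
      set h := t * |η j| / w j with hh
      set k := t * |η j| / w' j with hk
      have hh0 : 0 ≤ h := by positivity
      have hk0 : 0 ≤ k := by positivity
      have e1 : t * η j / w j = -h := by rw [hh, abs_of_nonpos hη0]; ring
      have e2 : t * η j / w' j = -k := by rw [hk, abs_of_nonpos hη0]; ring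
      have hhk : h + k ≤ x j - z j := by
        rw [abs_of_neg hlt] at hstep
        calc h + k = t * (|η j| / w j + |η j| / w' j) := by rw [hh, hk]; ring
          _ ≤ _ := by linarith
      rw [e1, e2]
      refine ⟨⟨by linarith, by linarith⟩, ⟨by linarith, by linarith⟩, ?_, ?_⟩
      · rw [abs_of_nonpos (by linarith), abs_of_neg hlt]; ring
      · have := topReward_exchange hs (x := z j) (h := k) (v := x j - h) (k := h) hwj' hz0 hk0 hh0
          (by linarith) (by linarith) (w' := w j) (by rw [hh, hk]; field_simp)
        rw [sub_add_cancel] at this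
        rw [sub_neg_eq_add, ← sub_eq_add_neg]
        linarith
    · have : η j = 0 := hzero (by simp [heq])
      simp [this, hx0, hx1, hz0, hz1]
    · have hη0 : 0 ≤ η j := by simpa [sign_pos hgt] using hsign
      set h := t * |η j| / w j with hh
      set k := t * |η j| / w' j with hk
      have hh0 : 0 ≤ h := by positivity
      have hk0 : 0 ≤ k := by positivity
      have e1 : t * η j / w j = h := by rw [hh, abs_of_nonneg hη0]
      have e2 : t * η j / w' j = k := by rw [hk, abs_of_nonneg hη0]
      have hhk : h + k ≤ z j - x j := by
        rw [abs_of_pos hgt] at hstep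
        calc h + k = t * (|η j| / w j + |η j| / w' j) := by rw [hh, hk]; ring
          _ ≤ _ := by linarith
      rw [e1, e2]
      refine ⟨⟨by linarith, by linarith⟩, ⟨by linarith, by linarith⟩, ?_, ?_⟩
      · rw [abs_of_nonneg (by linarith), abs_of_pos hgt]; ring
      · have := topReward_exchange hs (x := x j) (h := h) (v := z j - k) (k := k) hwj hx0 hh0 hk0
          (by linarith) (by linarith) (w' := w' j) (by rw [hh, hk]; field_simp)
        rwa [sub_add_cancel] at this
  have hfx : IsFeasibleProportion a w c fun j => x j + t * η j / w j := by
    refine ⟨fun j => (hcoord j).1, fun i => ?_⟩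
    have : ∑ j, w j * a j i * (x j + t * η j / w j) =
        ∑ j, w j * a j i * x j + t * ∑ j, a j i * η j := by
      rw [Finset.mul_sum, ← Finset.sum_add_distrib]
      refine Finset.sum_congr rfl fun j _ => ?_
      have := (hw j).ne'
      field_simp
    rw [this]
    linarith [ht2 i]
  have hfz : IsFeasibleProportion a w' c fun j => z j - t * η j / w' j := by
    refine ⟨fun j => (hcoord j).2.1, fun i => ?_⟩
    have : ∑ j, w' j * a j i * (z j - t * η j / w' j) =
        ∑ j, w' j * a j i * z j - t * ∑ j, a j i * η j := by
      rw [Finset.mul_sum, ← Finset.sum_sub_distrib]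
      refine Finset.sum_congr rfl fun j _ => ?_
      have := (hw' j).ne'
      field_simp
    rw [this]
    linarith [ht3 i]
  have hxopt := hx.2 _ hfx
  have hsum := Finset.sum_le_sum fun j (_ : j ∈ Finset.univ) => (hcoord j).2.2.2
  simp only [mul_sub, Finset.sum_sub_distrib] at hsum
  simp only [proportionReward_eq] at hxopt
  have hzopt : IsOptimalProportion a R w' c fun j => z j - t * η j / w' j := by
    refine ⟨hfz, fun q hq => (hz.2 q hq).trans ?_⟩
    simp only [proportionReward_eq]
    linarith
  have hcl := hclose _ hzopt
  simp only [fun j => (hcoord j).2.2.1, Finset.sum_sub_distrib] at hcl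
  obtain ⟨j, hj⟩ := Function.ne_iff.1 hne
  have : 0 < ∑ j, t * |η j| / w' j := by
    refine Finset.sum_pos' (fun j _ => by have := hw' j; positivity) ⟨j, Finset.mem_univ j, ?_⟩
    have := hw' j
    have : 0 < |η j| := abs_pos.2 hj
    positivity
  linarith

/-- Sensitivity constants exist, and they do not depend on the reward laws. -/
theorem exists_sensitivityConstant (p : Fin n → ℝ) (hp : ∀ j, 0 < p j) (a : Fin n → Fin m → ℝ)
    (ha : ∀ j i, 0 ≤ a j i) :
    ∃ κ : ℝ, 0 < κ ∧ ∀ (R : Rewards n) (α : ℝ), R.DensityBoundedBelow α →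
      IsSensitivityConstant p a R κ := by
  obtain ⟨κ₀, hκ₀, hbound⟩ := exists_uniform_bound a
  set A : ℝ := ∑ i, ∑ j, a j i with hA
  have hA0 : 0 ≤ A := Finset.sum_nonneg fun i _ => Finset.sum_nonneg fun j _ => ha j i
  set P : ℝ := ∑ j, 1 / p j with hP
  have hP0 : 0 ≤ P := Finset.sum_nonneg fun j _ => by have := hp j; positivity
  have hPj : ∀ j, 1 / p j ≤ P := fun j =>
    Finset.single_le_sum (f := fun j => 1 / p j) (fun k _ => by have := hp k; positivity)
      (Finset.mem_univ j)
  refine ⟨(κ₀ * (2 * A) + 1) * P + 1, by positivity, fun R α hR s c d x hs hc hd hx => ?_⟩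
  set Δ : ℝ := ⨆ k, |(d k : ℝ) / s - p k| with hΔ
  have hΔj : ∀ k, |(d k : ℝ) / s - p k| ≤ Δ := fun k =>
    le_ciSup (f := fun k => |(d k : ℝ) / s - p k|) (Set.finite_range _).bddAbove k
  have hΔ0 : 0 ≤ Δ := Real.iSup_nonneg fun k => abs_nonneg _
  have hs0 : (0 : ℝ) < s := by exact_mod_cast hs
  obtain ⟨z, hz, hclose⟩ := exists_closest_optimal (a := a) hR (fun j => (d j : ℝ)) hc x
  refine ⟨z, hz, fun j => ?_⟩
  by_cases hd0 : ∃ k, d k = 0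
  · -- then `Δ` is bounded below, and any two proportions differ by at most `1`
    obtain ⟨k, hk⟩ := hd0
    have h1 : p k ≤ Δ := by
      have := hΔj k
      rwa [hk, Nat.cast_zero, zero_div, zero_sub, abs_neg, abs_of_pos (hp k)] at this
    have h2 : 1 ≤ P * Δ := by
      calc (1 : ℝ) = 1 / p k * p k := by have := (hp k).ne'; field_simp
        _ ≤ P * Δ := mul_le_mul (hPj k) h1 (hp k).le hP0
    have h3 : |x j - z j| ≤ 1 := by
      rw [abs_le]
      constructor <;> linarith [(hx.1.1 j).1, (hx.1.1 j).2, (hz.1.1 j).1, (hz.1.1 j).2]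
    have h4 : 0 ≤ κ₀ * (2 * A) * (P * Δ) := by positivity
    calc |x j - z j| ≤ 1 := h3
      _ ≤ P * Δ := h2
      _ ≤ _ := by linarith
  · push Not at hd0
    have hdpos : ∀ k, (0 : ℝ) < d k := fun k => by exact_mod_cast Nat.pos_of_ne_zero (hd0 k)
    have hwpos : ∀ k, 0 < p k * s := fun k => mul_pos (hp k) hs0
    classical
    set I := Finset.univ.filter fun i => ∑ j, p j * s * a j i * x j = c i with hI
    set I' := Finset.univ.filter fun i => ∑ j, (d j : ℝ) * a j i * z j = c i with hI'
    set η : Fin n → ℝ := fun j => p j * s * (z j - x j) with hη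
    have hηmem : η ∈ signCone fun j => SignType.sign (z j - x j) := by
      intro j
      constructor
      · have : (SignType.sign (z j - x j) : ℝ) * η j = p j * s * |z j - x j| := by
          rw [hη, ← sign_mul_self (z j - x j)]; ring
        rw [this]
        exact mul_nonneg (hwpos j).le (abs_nonneg _)
      · intro h
        rw [sign_eq_zero_iff] at h
        simp [hη, h]
    have hnorm := hbound (fun j => SignType.sign (z j - x j)) I I'
      (fun η hη h1 h2 => eq_zero_of_exchange hR hwpos hdpos hx hz hclose hη
        (fun i hi => h1 i (by simpa [hI] using hi)) (fun i hi => h2 i (by simpa [hI'] using hi)))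
      η hηmem
    -- the violation comes from the change of weights only
    have hdiff : ∀ k, |(d k : ℝ) - p k * s| ≤ s * Δ := fun k => by
      have : (d k : ℝ) - p k * s = s * ((d k : ℝ) / s - p k) := by field_simp
      rw [this, abs_mul, abs_of_pos hs0]
      exact mul_le_mul_of_nonneg_left (hΔj k) hs0.le
    have hrow : ∀ i, |∑ j, a j i * η j -
        (∑ j, (d j : ℝ) * a j i * z j - ∑ j, p j * s * a j i * x j)| ≤ s * Δ * ∑ j, a j i := by
      intro i
      have : ∑ j, a j i * η j - (∑ j, (d j : ℝ) * a j i * z j - ∑ j, p j * s * a j i * x j) =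
          ∑ j, a j i * (-((d j : ℝ) - p j * s) * z j) := by
        rw [← Finset.sum_sub_distrib, ← Finset.sum_sub_distrib]
        exact Finset.sum_congr rfl fun j _ => by simp only [hη]; ring
      rw [this, Finset.mul_sum]
      refine (Finset.abs_sum_le_sum_abs _ _).trans (Finset.sum_le_sum fun j _ => ?_)
      rw [abs_mul, abs_mul, abs_neg, abs_of_nonneg (ha j i), abs_of_nonneg (hz.1.1 j).1, mul_comm]
      refine mul_le_mul_of_nonneg_right ?_ (ha j i)
      calc |(d j : ℝ) - p j * s| * z j ≤ |(d j : ℝ) - p j * s| :=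
            mul_le_of_le_one_right (abs_nonneg _) (hz.1.1 j).2
        _ ≤ _ := hdiff j
    have hnn : ∀ i, 0 ≤ s * Δ * ∑ j, a j i := fun i =>
      mul_nonneg (by positivity) (Finset.sum_nonneg fun j _ => ha j i)
    have hviol : rowViolation a I I' η ≤ 2 * A * (s * Δ) := by
      have e1 : ∑ i ∈ I, max (∑ j, a j i * η j) 0 ≤ ∑ i, s * Δ * ∑ j, a j i := by
        refine (Finset.sum_le_sum fun i hi => max_le ?_ (hnn i)).trans
          (Finset.sum_le_sum_of_subset_of_nonneg (Finset.subset_univ I) fun i _ _ => hnn i)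
        have h1 : ∑ j, p j * s * a j i * x j = c i := by simpa [hI] using hi
        linarith [(abs_le.1 (hrow i)).2, hz.1.2 i]
      have e2 : ∑ i ∈ I', max (-∑ j, a j i * η j) 0 ≤ ∑ i, s * Δ * ∑ j, a j i := by
        refine (Finset.sum_le_sum fun i hi => max_le ?_ (hnn i)).trans
          (Finset.sum_le_sum_of_subset_of_nonneg (Finset.subset_univ I') fun i _ _ => hnn i)
        have h1 : ∑ j, (d j : ℝ) * a j i * z j = c i := by simpa [hI'] using hi
        linarith [(abs_le.1 (hrow i)).1, hx.1.2 i]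
      rw [← Finset.mul_sum] at e1 e2
      unfold rowViolation
      linarith
    have hj : p j * s * |x j - z j| ≤ κ₀ * (2 * A * (s * Δ)) := by
      calc p j * s * |x j - z j| = ‖η j‖ := by
            rw [Real.norm_eq_abs, hη, abs_mul, abs_of_pos (hwpos j), abs_sub_comm]
        _ ≤ ‖η‖ := norm_le_pi_norm η j
        _ ≤ κ₀ * rowViolation a I I' η := hnorm
        _ ≤ _ := mul_le_mul_of_nonneg_left hviol hκ₀
    have h5 : |x j - z j| ≤ κ₀ * (2 * A) * Δ * (1 / p j) := by
      rw [mul_one_div, le_div_iff₀ (hp j)]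
      refine le_of_mul_le_mul_left ?_ hs0
      linarith
    calc |x j - z j| ≤ κ₀ * (2 * A) * Δ * (1 / p j) := h5
      _ ≤ κ₀ * (2 * A) * Δ * P := mul_le_mul_of_nonneg_left (hPj j) (by positivity)
      _ ≤ _ := by nlinarith [mul_nonneg hP0 hΔ0]

end Sensitivity

/-! ### The loss in one period -/

section OneStep

/-- Splitting `d` queries served at proportion `q` into one query served with probability `ρ` and
`d - 1` queries, whose proportion makes up for that decision: the first order terms cancel. -/
lemma split_loss_le {G : ℝ → ℝ} {L q g ρ d y₁ y₀ : ℝ} (hL : 0 ≤ L)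
    (hg : ∀ q' ∈ Set.Icc (0 : ℝ) 1, G q + g * (q' - q) - L * (q' - q) ^ 2 ≤ G q')
    (hq : q ∈ Set.Icc (0 : ℝ) 1) (hρ : ρ ∈ Set.Icc (0 : ℝ) 1) (hd : 1 < d)
    (hy₁ : (d - 1) * y₁ = d * q - 1) (hy₀ : (d - 1) * y₀ = d * q)
    (h₁ : 0 < ρ → y₁ ∈ Set.Icc (0 : ℝ) 1) (h₀ : ρ < 1 → y₀ ∈ Set.Icc (0 : ℝ) 1) :
    d * G q - ρ * ((d - 1) * G y₁) - (1 - ρ) * ((d - 1) * G y₀) - G ρ ≤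
      L * ((ρ - q) ^ 2 + 1 / (d - 1)) := by
  have hd' : 0 < d - 1 := by linarith
  have key : ∀ y e : ℝ, y ∈ Set.Icc (0 : ℝ) 1 → (d - 1) * (y - q) = e → e ^ 2 ≤ 1 →
      (d - 1) * G q + g * e - L * (1 / (d - 1)) ≤ (d - 1) * G y := by
    intro y e hy he he1
    have h := mul_le_mul_of_nonneg_left (hg y hy) hd'.le
    have h2 : (d - 1) * (y - q) ^ 2 ≤ 1 / (d - 1) := by
      rw [le_div_iff₀ hd']
      calc (d - 1) * (y - q) ^ 2 * (d - 1) = ((d - 1) * (y - q)) ^ 2 := by ring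
        _ ≤ 1 := by rw [he]; exact he1
    have h3 := mul_le_mul_of_nonneg_left h2 hL
    have h4 : g * ((d - 1) * (y - q)) = g * e := by rw [he]
    linarith
  have e1 : ρ * ((d - 1) * G q + g * (q - 1) - L * (1 / (d - 1))) ≤ ρ * ((d - 1) * G y₁) := by
    rcases hρ.1.eq_or_lt with h | h
    · simp [← h]
    · refine mul_le_mul_of_nonneg_left (key y₁ (q - 1) (h₁ h) (by linarith) ?_) hρ.1
      nlinarith [hq.1, hq.2]
  have e0 : (1 - ρ) * ((d - 1) * G q + g * q - L * (1 / (d - 1))) ≤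
      (1 - ρ) * ((d - 1) * G y₀) := by
    rcases hρ.2.eq_or_lt with h | h
    · simp [h]
    · refine mul_le_mul_of_nonneg_left (key y₀ q (h₀ h) (by linarith) ?_) (by linarith)
      nlinarith [hq.1, hq.2]
  have e2 := hg ρ hρ
  linarith

variable {m n : ℕ} {a : Fin n → Fin m → ℝ} {R : Rewards n} {α : ℝ}

lemma cast_add_single (d : Fin n → ℕ) (j k : Fin n) :
    (((d + Pi.single j 1 : Fin n → ℕ) k : ℕ) : ℝ) = d k + if k = j then 1 else 0 := by
  by_cases h : k = j
  · subst h; simp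
  · simp [h]

/-- With one query of type `j` less, and with the capacity that an amount `σ` of it uses removed,
the proportions of the other types can be kept. -/
lemma le_semiFluid_of_remove (hR : R.DensityBoundedBelow α) {c : Fin m → ℝ} {d : Fin n → ℕ}
    {j : Fin n} {q : Fin n → ℝ} {σ y : ℝ}
    (hq : IsFeasibleProportion a (fun k => ((d + Pi.single j 1 : Fin n → ℕ) k : ℝ)) c q)
    (hy : y ∈ Set.Icc (0 : ℝ) 1) (hyσ : (d j : ℝ) * y = (d j + 1) * q j - σ) :
    proportionReward R (fun k => ((d + Pi.single j 1 : Fin n → ℕ) k : ℝ)) q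
        - (d j + 1) * topReward (R.F j) (q j) + d j * topReward (R.F j) y ≤
      semiFluid a R (fun i => c i - a j i * σ) d := by
  have hfeas : IsFeasibleProportion a (fun k => (d k : ℝ)) (fun i => c i - a j i * σ)
      (Function.update q j y) := by
    refine ⟨fun k => ?_, fun i => ?_⟩
    · by_cases h : k = j
      · subst h; simpa using hy
      · simpa [h] using hq.1 k
    · have h1 := hq.2 i
      simp only [cast_add_single] at h1
      rw [← Finset.add_sum_erase _ _ (Finset.mem_univ j)] at h1 ⊢
      have h2 : ∑ k ∈ Finset.univ.erase j, (d k : ℝ) * a k i * Function.update q j y k =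
          ∑ k ∈ Finset.univ.erase j, ((d k : ℝ) + if k = j then 1 else 0) * a k i * q k :=
        Finset.sum_congr rfl fun k hk => by simp [Finset.ne_of_mem_erase hk]
      rw [h2]
      simp only [if_true, Function.update_self] at h1 ⊢
      have h3 : (d j : ℝ) * a j i * y = a j i * ((d j + 1) * q j - σ) := by rw [← hyσ]; ring
      linarith
  refine le_trans (le_of_eq ?_) (le_semiFluid hR hfeas)
  simp only [proportionReward_eq, cast_add_single]
  rw [← Finset.add_sum_erase _ _ (Finset.mem_univ j), ← Finset.add_sum_erase _
    (fun k => (d k : ℝ) * topReward (R.F k) (Function.update q j y k)) (Finset.mem_univ j)]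
  have h2 : ∑ k ∈ Finset.univ.erase j, (d k : ℝ) * topReward (R.F k) (Function.update q j y k) =
      ∑ k ∈ Finset.univ.erase j, ((d k : ℝ) + if k = j then 1 else 0) * topReward (R.F k) (q k) :=
    Finset.sum_congr rfl fun k hk => by simp [Finset.ne_of_mem_erase hk]
  rw [h2]
  simp only [if_true, Function.update_self]
  ring

/-- What the semi-fluid relaxation loses in the period of the query `x`, when `s` periods and
capacities `c` remain and there will be `d j` queries of type `j` afterwards. -/
noncomputable def oneStepLoss (a : Fin n → Fin m → ℝ) (R : Rewards n)
    (M : ℕ → (Fin m → ℝ) → Fin n → ℝ) (s : ℕ) (c : Fin m → ℝ) (d : Fin n → ℕ) (x : Fin n × ℝ) : ℝ :=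
  semiFluid a R c (d + Pi.single x.1 1) - semiFluid a R (nextCapacity a M s c x) d
    - x.2 * decision a M s c x

variable (M : ℕ → (Fin m → ℝ) → Fin n → ℝ) (s : ℕ)

lemma decision_eq_zero_or_one (c : Fin m → ℝ) (x : Fin n × ℝ) :
    decision a M s c x = 0 ∨ decision a M s c x = 1 := by
  unfold decision
  split_ifs <;> simp

lemma measurable_decision (c : Fin m → ℝ) (j : Fin n) :
    Measurable fun r : ℝ => decision a M s c (j, r) := by
  unfold decision
  refine Measurable.ite ?_ measurable_const measurable_const
  exact (measurableSet_Ici (a := M s c j)).inter (MeasurableSet.const (∀ i, a j i ≤ c i))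

lemma nextCapacity_nonneg {c : Fin m → ℝ} (hc : ∀ i, 0 ≤ c i) (x : Fin n × ℝ) (i : Fin m) :
    0 ≤ nextCapacity a M s c x i := by
  unfold nextCapacity decision
  split_ifs with h
  · simpa using h.2 i
  · simpa using hc i

lemma oneStepLoss_eq (c : Fin m → ℝ) (d : Fin n → ℕ) (j : Fin n) (r : ℝ) :
    oneStepLoss a R M s c d (j, r) = semiFluid a R c (d + Pi.single j 1) - semiFluid a R c d
      - decision a M s c (j, r) *
        (semiFluid a R (fun i => c i - a j i * 1) d - semiFluid a R c d)
      - r * decision a M s c (j, r) := by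
  unfold oneStepLoss nextCapacity
  rcases decision_eq_zero_or_one M s c (j, r) (a := a) with h | h <;> simp [h]

lemma integrable_id_law (hR : R.DensityBoundedBelow α) (j : Fin n) :
    Integrable (fun r : ℝ => r) (R.F j) := by
  have := hR.isProb j
  exact Integrable.of_mem_Icc _ _ measurable_id.aemeasurable (hR.ae_mem j)

lemma integrable_decision (hR : R.DensityBoundedBelow α) (c : Fin m → ℝ) (j : Fin n) :
    Integrable (fun r => decision a M s c (j, r)) (R.F j) := by
  have := hR.isProb j
  refine Integrable.of_bound (measurable_decision M s c j).aestronglyMeasurable 1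
    (Filter.Eventually.of_forall fun r => ?_)
  rcases decision_eq_zero_or_one M s c (j, r) (a := a) with h | h <;> simp [h]

lemma integrable_mul_decision (hR : R.DensityBoundedBelow α) (c : Fin m → ℝ) (j : Fin n) :
    Integrable (fun r => r * decision a M s c (j, r)) (R.F j) := by
  refine (integrable_id_law hR j).mono
    (measurable_id.mul (measurable_decision M s c j)).aestronglyMeasurable
    (Filter.Eventually.of_forall fun r => ?_)
  rcases decision_eq_zero_or_one M s c (j, r) (a := a) with h | h <;> simp [h]

lemma integrable_oneStepLoss (hR : R.DensityBoundedBelow α) (c : Fin m → ℝ) (d : Fin n → ℕ)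
    (j : Fin n) : Integrable (fun r => oneStepLoss a R M s c d (j, r)) (R.F j) := by
  have := hR.isProb j
  simp only [oneStepLoss_eq]
  exact ((integrable_const _).sub ((integrable_decision M s hR c j).mul_const _)).sub
    (integrable_mul_decision M s hR c j)

lemma oneStepLoss_le (hR : R.DensityBoundedBelow α) {U : ℝ} (hU : ∀ j, R.u j ≤ U)
    {c : Fin m → ℝ} (hc : ∀ i, 0 ≤ c i) (d : Fin n → ℕ) {x : Fin n × ℝ} (hx : 0 ≤ x.2) :
    oneStepLoss a R M s c d x ≤ (∑ j, d j + 1 : ℕ) * U := by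
  have h1 := semiFluid_le_mul (a := a) hc hR hU (d + Pi.single x.1 1)
  have h2 := semiFluid_nonneg (a := a) (nextCapacity_nonneg (a := a) M s hc x) hR d
  have h3 : 0 ≤ x.2 * decision a M s c x := by
    rcases decision_eq_zero_or_one M s c x (a := a) with h | h <;> simp [h, hx]
  have h4 : ∑ j, (d + Pi.single x.1 1 : Fin n → ℕ) j = ∑ j, d j + 1 := by
    simp [Finset.sum_add_distrib]
  rw [h4] at h1
  unfold oneStepLoss
  linarith

lemma integral_oneStepLoss_le (hR : R.DensityBoundedBelow α) {U : ℝ} (hU : ∀ j, R.u j ≤ U)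
    {c : Fin m → ℝ} (hc : ∀ i, 0 ≤ c i) (d : Fin n → ℕ) (j : Fin n) :
    ∫ r, oneStepLoss a R M s c d (j, r) ∂(R.F j) ≤ (∑ j, d j + 1 : ℕ) * U := by
  have := hR.isProb j
  have h := integral_mono_ae (integrable_oneStepLoss (a := a) M s hR c d j)
    (integrable_const ((∑ j, d j + 1 : ℕ) * U))
    ((hR.ae_mem j).mono fun r hr => oneStepLoss_le M s hR hU hc d ((hR j).1.trans hr.1))
  simpa using h

/-- The expected loss when a query of type `j` would be served with probability `ρ` if there were
no capacity constraints, in terms of an optimal solution `q` that knows the numbers of queries. -/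
lemma integral_oneStepLoss_le_of_optimal (hR : R.DensityBoundedBelow α) (ha : ∀ j i, 0 ≤ a j i)
    {c : Fin m → ℝ} (hc : ∀ i, 0 ≤ c i) {d : Fin n → ℕ} {j : Fin n} {q : Fin n → ℝ} {ρ L : ℝ}
    (hq : IsOptimalProportion a R (fun k => ((d + Pi.single j 1 : Fin n → ℕ) k : ℝ)) c q)
    (hd : 1 ≤ d j) (hL : 0 ≤ L)
    (hslope : ∀ x ∈ Set.Icc (0 : ℝ) 1, ∃ g, ∀ x' ∈ Set.Icc (0 : ℝ) 1,
      topReward (R.F j) x + g * (x' - x) - L * (x' - x) ^ 2 ≤ topReward (R.F j) x')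
    (hρ : ρ ∈ Set.Icc (0 : ℝ) 1)
    (hprob : ∫ r, (if M s c j ≤ r then (1 : ℝ) else 0) ∂(R.F j) = ρ)
    (hrew : ∫ r, r * (if M s c j ≤ r then (1 : ℝ) else 0) ∂(R.F j) = topReward (R.F j) ρ)
    (h₁ : 0 < ρ → 1 ≤ (d j + 1) * q j) (h₀ : ρ < 1 → 1 ≤ (d j + 1) * (1 - q j)) :
    ∫ r, oneStepLoss a R M s c d (j, r) ∂(R.F j) ≤ L * ((ρ - q j) ^ 2 + 1 / d j) := by
  have := hR.isProb j
  have hd0 : (0 : ℝ) < d j := by exact_mod_cast hd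
  have hqj := hq.1.1 j
  -- capacity never blocks a query that the threshold accepts
  have hdec : (fun r => decision a M s c (j, r)) =ᵐ[R.F j]
      fun r => if M s c j ≤ r then (1 : ℝ) else 0 := by
    rcases hρ.1.eq_or_lt with h | h
    · have hm : Measurable fun r : ℝ => if M s c j ≤ r then (1 : ℝ) else 0 :=
        Measurable.ite measurableSet_Ici measurable_const measurable_const
      have h0 : (fun r : ℝ => if M s c j ≤ r then (1 : ℝ) else 0) =ᵐ[R.F j] 0 := by
        rw [← integral_eq_zero_iff_of_nonneg]
        · rw [hprob, h]
        · intro r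
          dsimp only [Pi.zero_apply]
          split_ifs <;> norm_num
        · refine Integrable.of_bound hm.aestronglyMeasurable 1 (Filter.Eventually.of_forall ?_)
          intro r
          split_ifs <;> simp
      filter_upwards [h0] with r hr
      have hr' : ¬ M s c j ≤ r := by
        intro hle
        simp [hle] at hr
      simp [decision, hr']
    · have hcap : ∀ i, a j i ≤ c i := by
        intro i
        have h2 := hq.1.2 i
        have h3 := Finset.single_le_sum
          (f := fun k => ((d + Pi.single j 1 : Fin n → ℕ) k : ℝ) * a k i * q k)
          (fun k _ => mul_nonneg (mul_nonneg (Nat.cast_nonneg _) (ha k i)) (hq.1.1 k).1)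
          (Finset.mem_univ j)
        simp only [cast_add_single, if_true] at h2 h3
        nlinarith [h₁ h, ha j i]
      exact Filter.Eventually.of_forall fun r => by simp [decision, hcap]
  have hint : ∫ r, oneStepLoss a R M s c d (j, r) ∂(R.F j) =
      semiFluid a R c (d + Pi.single j 1) - ρ * semiFluid a R (fun i => c i - a j i * 1) d
        - (1 - ρ) * semiFluid a R c d - topReward (R.F j) ρ := by
    have hmul : ∫ r, r * decision a M s c (j, r) ∂(R.F j) = topReward (R.F j) ρ := by
      rw [← hrew]
      exact integral_congr_ae (hdec.mono fun r hr => by simp only at hr ⊢; rw [hr])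
    simp only [oneStepLoss_eq]
    have i1 := integrable_decision (a := a) M s hR c j
    have i2 := integrable_mul_decision (a := a) M s hR c j
    have i3 : Integrable (fun r => semiFluid a R c (d + Pi.single j 1) - semiFluid a R c d -
        decision a M s c (j, r) * (semiFluid a R (fun i => c i - a j i * 1) d -
          semiFluid a R c d)) (R.F j) := (integrable_const _).sub (i1.mul_const _)
    rw [integral_sub i3 i2,
      integral_sub (integrable_const _) (i1.mul_const _), integral_mul_const,
      integral_congr_ae hdec, hprob, hmul]
    simp
    ring
  have hV := semiFluid_le_of_optimal hc hR hq
  set W := proportionReward R (fun k => ((d + Pi.single j 1 : Fin n → ℕ) k : ℝ)) q with hW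
  obtain ⟨g, hg⟩ := hslope (q j) hqj
  have hmem₁ : 0 < ρ → ((d j + 1) * q j - 1) / d j ∈ Set.Icc (0 : ℝ) 1 := fun h =>
    ⟨div_nonneg (by linarith [h₁ h]) hd0.le, (div_le_one hd0).2 (by nlinarith [hqj.2])⟩
  have hmem₀ : ρ < 1 → (d j + 1) * q j / d j ∈ Set.Icc (0 : ℝ) 1 := fun h =>
    ⟨div_nonneg (by nlinarith [hqj.1]) hd0.le, (div_le_one hd0).2 (by nlinarith [h₀ h])⟩
  have hsplit := split_loss_le (d := d j + 1) hL hg hqj hρ (by linarith)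
    (y₁ := ((d j + 1) * q j - 1) / d j) (y₀ := (d j + 1) * q j / d j)
    (by rw [add_sub_cancel_right, mul_div_cancel₀ _ hd0.ne'])
    (by rw [add_sub_cancel_right, mul_div_cancel₀ _ hd0.ne']) hmem₁ hmem₀
  rw [add_sub_cancel_right] at hsplit
  have e1 : ρ * (W - (d j + 1) * topReward (R.F j) (q j) +
      d j * topReward (R.F j) (((d j + 1) * q j - 1) / d j)) ≤
      ρ * semiFluid a R (fun i => c i - a j i * 1) d := by
    rcases hρ.1.eq_or_lt with h | h
    · simp [← h]
    · exact mul_le_mul_of_nonneg_left (le_semiFluid_of_remove hR hq.1 (hmem₁ h)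
        (mul_div_cancel₀ _ hd0.ne')) hρ.1
  have e0 : (1 - ρ) * (W - (d j + 1) * topReward (R.F j) (q j) +
      d j * topReward (R.F j) ((d j + 1) * q j / d j)) ≤ (1 - ρ) * semiFluid a R c d := by
    rcases hρ.2.eq_or_lt with h | h
    · simp [h]
    · have := le_semiFluid_of_remove (σ := 0) hR hq.1 (hmem₀ h)
        (by rw [mul_div_cancel₀ _ hd0.ne', sub_zero])
      simp only [mul_zero, sub_zero] at this
      exact mul_le_mul_of_nonneg_left this (by linarith)
  rw [hint]
  linarith

end OneStep

/-! ### The boundary-attracted policy in one period -/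

section Policy

variable {m n : ℕ} {a : Fin n → Fin m → ℝ} {R : Rewards n} {α : ℝ}

/-- The threshold of the policy serves with a probability `ρ` close to the fluid solution, unless
`topReward` is linear, and `ρ` is pushed to `1` or `0` near the boundary. -/
lemma exists_boundaryEstimator_prob (hα : 0 < α) (hR : R.DensityBoundedBelow α) {κ : ℝ}
    {qhat : ℕ → (Fin m → ℝ) → Fin n → ℝ} {s : ℕ} {c : Fin m → ℝ} {j : Fin n}
    (hq : qhat s c j ∈ Set.Icc (0 : ℝ) 1) {ε : ℝ} (hε : 3 * κ * √(Real.log s / s) = ε)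
    (hε0 : 0 < ε) (hε1 : ε < 1 / 2) :
    ∃ ρ L : ℝ, ρ ∈ Set.Icc (0 : ℝ) 1 ∧ 0 ≤ L ∧ L ≤ 1 / α ∧
      (∀ x ∈ Set.Icc (0 : ℝ) 1, ∃ g, ∀ x' ∈ Set.Icc (0 : ℝ) 1,
        topReward (R.F j) x + g * (x' - x) - L * (x' - x) ^ 2 ≤ topReward (R.F j) x') ∧
      ∫ r, (if boundaryEstimator R κ qhat s c j ≤ r then (1 : ℝ) else 0) ∂(R.F j) = ρ ∧
      ∫ r, r * (if boundaryEstimator R κ qhat s c j ≤ r then (1 : ℝ) else 0) ∂(R.F j) =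
        topReward (R.F j) ρ ∧
      (0 < ρ → ε < qhat s c j) ∧ (ρ < 1 → qhat s c j < 1 - ε) ∧
      (L = 0 ∨ |ρ - qhat s c j| ≤ ε) := by
  have := hR.isProb j
  have hs := hR.ae_mem j
  have hone : ∀ θ, (∀ᵐ r ∂(R.F j), θ ≤ r) →
      ∫ r, (if θ ≤ r then (1 : ℝ) else 0) ∂(R.F j) = 1 ∧
      ∫ r, r * (if θ ≤ r then (1 : ℝ) else 0) ∂(R.F j) = topReward (R.F j) 1 := by
    intro θ hθ
    constructor
    · rw [integral_congr_ae (g := fun _ => (1 : ℝ)) (hθ.mono fun r hr => by simp [hr])]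
      simp
    · rw [integral_congr_ae (g := fun r => r) (hθ.mono fun r hr => by simp [hr]), topReward_one hs]
  have hnone : ∀ θ, (∀ᵐ r ∂(R.F j), ¬ θ ≤ r) →
      ∫ r, (if θ ≤ r then (1 : ℝ) else 0) ∂(R.F j) = 0 ∧
      ∫ r, r * (if θ ≤ r then (1 : ℝ) else 0) ∂(R.F j) = topReward (R.F j) 0 := by
    intro θ hθ
    constructor
    · rw [integral_congr_ae (g := fun _ => (0 : ℝ)) (hθ.mono fun r hr => by simp [hr])]
      simp
    · rw [integral_congr_ae (g := fun _ => (0 : ℝ)) (hθ.mono fun r hr => by simp [hr]),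
        topReward_zero]
      simp
  rcases (hR j).2.2 with ⟨hlu, f, hf, hfα, hF⟩ | ⟨hlu, hF⟩
  · obtain ⟨-, h0, hd⟩ := withDensity_props f hf hfα hF
    have hslope := fun x (hx : x ∈ Set.Icc (0 : ℝ) 1) => exists_slope hs hα hd hx
    by_cases h1 : 1 - ε ≤ qhat s c j
    · have hM : boundaryEstimator R κ qhat s c j = R.l j := by
        simp only [boundaryEstimator, hε, if_pos h1]
      rw [hM]
      obtain ⟨e1, e2⟩ := hone (R.l j) (hs.mono fun r hr => hr.1)
      refine ⟨1, 1 / α, by simp, by positivity, le_rfl, hslope, e1, e2, fun _ => by linarith,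
        fun h => absurd h (lt_irrefl _), Or.inr ?_⟩
      rw [abs_of_nonneg (by linarith [hq.2])]
      linarith
    by_cases h2 : qhat s c j ≤ ε
    · have hM : boundaryEstimator R κ qhat s c j = R.u j := by
        simp only [boundaryEstimator, hε, if_neg h1, if_pos h2, if_pos hlu]
      rw [hM]
      have hne : ∀ᵐ r ∂(R.F j), r ≠ R.u j := by
        rw [ae_iff]
        simpa using h0 (R.u j)
      obtain ⟨e1, e2⟩ := hnone (R.u j) (by
        filter_upwards [hs, hne] with r hr hr' h using hr' (le_antisymm hr.2 h))
      refine ⟨0, 1 / α, by simp, by positivity, le_rfl, hslope, e1, e2,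
        fun h => absurd h (lt_irrefl _), fun _ => by linarith, Or.inr ?_⟩
      rw [zero_sub, abs_neg, abs_of_nonneg hq.1]
      exact h2
    · have hM : boundaryEstimator R κ qhat s c j = quantile (R.F j) (1 - qhat s c j) := by
        simp only [boundaryEstimator, hε, if_neg h1, if_neg h2]
      rw [hM]
      push Not at h1 h2
      obtain ⟨e1, e2⟩ := integral_threshold hs h0 hq.1 (by linarith)
      exact ⟨qhat s c j, 1 / α, hq, by positivity, le_rfl, hslope, e1, e2, fun _ => h2,
        fun _ => h1, Or.inr (by simpa using hε0.le)⟩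
  · have hslope : ∀ x ∈ Set.Icc (0 : ℝ) 1, ∃ g, ∀ x' ∈ Set.Icc (0 : ℝ) 1,
        topReward (R.F j) x + g * (x' - x) - 0 * (x' - x) ^ 2 ≤ topReward (R.F j) x' := by
      intro x hx
      refine ⟨R.l j, fun x' hx' => ?_⟩
      rw [hF, topReward_dirac hx, topReward_dirac hx']
      linarith
    have hpos : 0 ≤ 1 / α := by positivity
    by_cases h2 : qhat s c j ≤ ε
    · have h1 : ¬ 1 - ε ≤ qhat s c j := by linarith
      have hM : boundaryEstimator R κ qhat s c j = R.u j + 1 := by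
        simp only [boundaryEstimator, hε, if_neg h1, if_pos h2, if_neg hlu.not_lt]
      rw [hM]
      obtain ⟨e1, e2⟩ := hnone (R.u j + 1) (hs.mono fun r hr h => by linarith [hr.2])
      exact ⟨0, 0, by simp, le_rfl, hpos, hslope, e1, e2, fun h => absurd h (lt_irrefl _),
        fun _ => by linarith, Or.inl rfl⟩
    · have hM : boundaryEstimator R κ qhat s c j = R.l j := by
        by_cases h1 : 1 - ε ≤ qhat s c j
        · simp only [boundaryEstimator, hε, if_pos h1]
        · have hmem := quantile_mem_Icc hs (z := 1 - qhat s c j)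
            ⟨by linarith, by linarith [hq.1]⟩
          rw [← hlu] at hmem
          simpa only [boundaryEstimator, hε, if_neg h1, if_neg h2] using le_antisymm hmem.2 hmem.1
      rw [hM]
      obtain ⟨e1, e2⟩ := hone (R.l j) (hs.mono fun r hr => hr.1)
      exact ⟨1, 0, by simp, le_rfl, hpos, hslope, e1, e2, fun _ => by linarith,
        fun h => absurd h (lt_irrefl _), Or.inl rfl⟩

/-- The type counts `d` of `s` queries are typical if all frequencies are within `√(log s / s)` of
the type probabilities. -/
def IsTypical (p : Fin n → ℝ) (s : ℕ) (d : Fin n → ℕ) : Prop :=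
  ∀ k, |(d k : ℝ) / s - p k| ≤ √(Real.log s / s)

/-- The conditions under which `s` counts as large. -/
lemma eventually_large (p : Fin n → ℝ) (hp : ∀ j, 0 < p j) {κ : ℝ} (hκ : 0 < κ) :
    ∀ᶠ s : ℕ in Filter.atTop, 3 * κ * √(Real.log s / s) < 1 / 2 ∧
      ∀ j, √(Real.log s / s) ≤ p j / 2 ∧ 1 ≤ κ * √(Real.log s / s) * (p j * s) ∧ 4 ≤ p j * s := by
  have hlog : Filter.Tendsto (fun s : ℕ => Real.log s / s) Filter.atTop (nhds 0) :=
    Real.isLittleO_log_id_atTop.tendsto_div_nhds_zero.comp tendsto_natCast_atTop_atTop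
  have hsqrt : Filter.Tendsto (fun s : ℕ => √(Real.log s / s)) Filter.atTop (nhds 0) := by
    simpa using hlog.sqrt
  have hsN : Filter.Tendsto (fun s : ℕ => (s : ℝ)) Filter.atTop Filter.atTop :=
    tendsto_natCast_atTop_atTop
  refine Filter.Eventually.and ?_ (Filter.eventually_all.2 fun j =>
    Filter.Eventually.and ?_ (Filter.Eventually.and ?_ ?_))
  · have h := hsqrt.const_mul (3 * κ)
    rw [mul_zero] at h
    exact h.eventually_lt_const (by norm_num)
  · exact (hsqrt.eventually_lt_const (half_pos (hp j))).mono fun s hs => hs.le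
  · have hpj := hp j
    -- `√(log s / s) * s ≥ √s` once `log s ≥ 1`
    filter_upwards [hsN.eventually_ge_atTop (Real.exp 1),
      hsN.eventually_ge_atTop ((1 / (κ * p j)) ^ 2)] with s h1 h2
    have hs0 : (0 : ℝ) < s := (Real.exp_pos 1).trans_le h1
    have hl : 1 ≤ Real.log s := (Real.le_log_iff_exp_le hs0).2 h1
    have h3 : √(1 / s) ≤ √(Real.log s / s) := Real.sqrt_le_sqrt (by gcongr)
    have h4 : 1 / (κ * p j) ≤ √s := Real.le_sqrt_of_sq_le h2
    have h5 : √(1 / s) * s = √s := by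
      rw [Real.sqrt_div zero_le_one, Real.sqrt_one, one_div_mul_eq_div, Real.div_sqrt]
    calc (1 : ℝ) = κ * p j * (1 / (κ * p j)) := by field_simp
      _ ≤ κ * p j * (√(1 / s) * s) := by rw [h5]; gcongr
      _ ≤ κ * p j * (√(Real.log s / s) * s) := by gcongr
      _ = _ := by ring
  · have hpj := hp j
    filter_upwards [hsN.eventually_ge_atTop (4 / p j)] with s h
    rwa [div_le_iff₀' hpj] at h

/-- If many periods remain and the type counts turn out typical, the policy loses `O(log s / s)`. -/
lemma exists_integral_oneStepLoss_le (p : Fin n → ℝ) (hp : ∀ j, 0 < p j)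
    (a : Fin n → Fin m → ℝ) (ha : ∀ j i, 0 ≤ a j i) {κ α : ℝ} (hκ : 0 < κ) (hα : 0 < α) :
    ∃ (K : ℝ) (S : ℕ), 0 < K ∧ ∀ R : Rewards n, R.DensityBoundedBelow α →
      IsSensitivityConstant p a R κ → ∀ qhat, IsFluidSolver p a R qhat →
      ∀ s : ℕ, S ≤ s → ∀ c : Fin m → ℝ, (∀ i, 0 ≤ c i) → ∀ (d : Fin n → ℕ) (j : Fin n),
        ∑ k, d k + 1 = s → IsTypical p s (d + Pi.single j 1) →
        ∫ r, oneStepLoss a R (boundaryEstimator R κ qhat) s c d (j, r) ∂(R.F j) ≤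
          K * (Real.log s / s) := by
  obtain ⟨S, hS⟩ := Filter.eventually_atTop.1 (eventually_large p hp hκ)
  set P : ℝ := ∑ j, 1 / p j with hP
  have hP0 : 0 ≤ P := Finset.sum_nonneg fun j _ => by have := hp j; positivity
  have hPj : ∀ j, 1 / p j ≤ P := fun j =>
    Finset.single_le_sum (f := fun j => 1 / p j) (fun k _ => by have := hp k; positivity)
      (Finset.mem_univ j)
  refine ⟨1 / α * (16 * κ ^ 2 + 8 * P), max S 2, by positivity, ?_⟩
  intro R hR hsens qhat hsolve s hs c hc d j hsum htyp
  have hs2 : 2 ≤ s := (le_max_right _ _).trans hs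
  obtain ⟨hε1, hlarge⟩ := hS s ((le_max_left _ _).trans hs)
  obtain ⟨hδj, hκδ, hps⟩ := hlarge j
  have hpj := hp j
  have hs0 : (0 : ℝ) < s := by positivity
  have hlog2 : 1 / 2 ≤ Real.log s := by
    have h1 : Real.log 2 ≤ Real.log s :=
      Real.log_le_log two_pos (by exact_mod_cast hs2)
    linarith [Real.log_two_gt_d9]
  set δ := √(Real.log s / s) with hδ
  have hδ0 : 0 < δ := Real.sqrt_pos.2 (by positivity)
  have hδsq : δ ^ 2 = Real.log s / s := Real.sq_sqrt (by positivity)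
  have hopt := hsolve s c (by omega) hc
  have hdsum : ∑ k, (d + Pi.single j 1 : Fin n → ℕ) k = s := by
    rw [← hsum]; simp [Finset.sum_add_distrib]
  obtain ⟨q, hq, hclose⟩ := hsens s c _ _ (by omega) hc hdsum hopt
  have hsup : ⨆ k, |((d + Pi.single j 1 : Fin n → ℕ) k : ℝ) / s - p k| ≤ δ := by
    have : Nonempty (Fin n) := ⟨j⟩
    exact ciSup_le htyp
  have hqj : |qhat s c j - q j| ≤ κ * δ :=
    (hclose j).trans (mul_le_mul_of_nonneg_left hsup hκ.le)
  obtain ⟨ρ, L, hρ, hL, hLα, hslope, e1, e2, h₁, h₀, hLρ⟩ :=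
    exists_boundaryEstimator_prob hα hR (κ := κ) (qhat := qhat) (s := s) (c := c) (j := j)
      (hopt.1.1 j) rfl (by positivity) hε1
  -- a typical number of queries of type `j` is at least half of its mean
  have hdj : p j * s / 2 ≤ d j + 1 := by
    have h := (abs_le.1 (htyp j)).1
    rw [cast_add_single, if_pos rfl] at h
    have h' : p j / 2 ≤ (d j + 1) / s := by linarith
    rw [le_div_iff₀ hs0] at h'
    linarith
  have hd1 : (1 : ℝ) ≤ d j := by linarith
  have hd1' : 1 ≤ d j := by exact_mod_cast hd1
  have hmul : 1 ≤ (d j + 1) * (2 * (κ * δ)) := by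
    calc (1 : ℝ) ≤ κ * δ * (p j * s) := hκδ
      _ = (p j * s / 2) * (2 * (κ * δ)) := by ring
      _ ≤ _ := by gcongr
  have hqj' := abs_le.1 hqj
  refine (integral_oneStepLoss_le_of_optimal (a := a) _ s hR ha hc hq hd1' hL hslope hρ e1 e2
    (fun h => hmul.trans ?_) (fun h => hmul.trans ?_)).trans ?_
  · have := h₁ h
    gcongr
    linarith
  · have := h₀ h
    gcongr
    linarith
  · have hsq : L * (ρ - q j) ^ 2 ≤ L * (16 * κ ^ 2 * δ ^ 2) := by
      rcases hLρ with h | h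
      · simp [h]
      · refine mul_le_mul_of_nonneg_left ?_ hL
        have h4 : |ρ - q j| ≤ 4 * (κ * δ) := by
          calc |ρ - q j| ≤ |ρ - qhat s c j| + |qhat s c j - q j| := abs_sub_le _ _ _
            _ ≤ 3 * κ * δ + κ * δ := add_le_add h hqj
            _ = _ := by ring
        calc (ρ - q j) ^ 2 = |ρ - q j| ^ 2 := (sq_abs _).symm
          _ ≤ (4 * (κ * δ)) ^ 2 := by gcongr
          _ = _ := by ring
    have hinv : 1 / (d j : ℝ) ≤ 8 * P * (Real.log s / s) := by
      have h1 : p j * s / 4 ≤ d j := by linarith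
      calc 1 / (d j : ℝ) ≤ 1 / (p j * s / 4) := by gcongr
        _ = 8 * (1 / p j) * (1 / 2 / s) := by field_simp; norm_num
        _ ≤ 8 * P * (Real.log s / s) := by
          gcongr
          exact hPj j
    calc L * ((ρ - q j) ^ 2 + 1 / d j) = L * (ρ - q j) ^ 2 + L * (1 / d j) := by ring
      _ ≤ L * (16 * κ ^ 2 * δ ^ 2) + L * (8 * P * (Real.log s / s)) := by gcongr
      _ = L * ((16 * κ ^ 2 + 8 * P) * (Real.log s / s)) := by rw [hδsq]; ring
      _ ≤ 1 / α * ((16 * κ ^ 2 + 8 * P) * (Real.log s / s)) := by gcongr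
      _ = _ := by ring

end Policy

/-! ### The law of a problem instance -/

section InstanceLaw

variable {n : ℕ} {p : Fin n → ℝ} {R : Rewards n} {α : ℝ}

lemma isProbabilityMeasure_queryLaw (hR : R.DensityBoundedBelow α) (hp : ∀ j, 0 < p j)
    (hsum : ∑ j, p j = 1) : IsProbabilityMeasure (queryLaw p R) := by
  constructor
  have h : ∀ j, (ENNReal.ofReal (p j) • (R.F j).map (fun r => (j, r))) Set.univ =
      ENNReal.ofReal (p j) := fun j => by
    have := hR.isProb j
    have : IsProbabilityMeasure ((R.F j).map (fun r => (j, r))) :=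
      Measure.isProbabilityMeasure_map (by fun_prop)
    simp
  rw [queryLaw, Measure.finsetSum_apply]
  simp only [h]
  rw [← ENNReal.ofReal_sum_of_nonneg fun j _ => (hp j).le, hsum, ENNReal.ofReal_one]

lemma integral_queryLaw (hp : ∀ j, 0 < p j) {f : Fin n × ℝ → ℝ}
    (hf : ∀ j, Integrable (fun r => f (j, r)) (R.F j)) :
    ∫ x, f x ∂(queryLaw p R) = ∑ j, p j * ∫ r, f (j, r) ∂(R.F j) := by
  have he : ∀ j : Fin n, MeasurableEmbedding (fun r : ℝ => (j, r)) := fun j =>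
    measurableEmbedding_prodMk_left j
  rw [queryLaw, integral_finsetSum_measure]
  · refine Finset.sum_congr rfl fun j _ => ?_
    rw [integral_smul_measure, (he j).integral_map, ENNReal.toReal_ofReal (hp j).le, smul_eq_mul]
  · intro j _
    exact Integrable.smul_measure ((he j).integrable_map_iff.2 (hf j)) ENNReal.ofReal_ne_top

lemma ae_queryLaw (hR : R.DensityBoundedBelow α) :
    ∀ᵐ x ∂(queryLaw p R), x.2 ∈ Set.Icc (R.l x.1) (R.u x.1) := by
  have he : ∀ j : Fin n, MeasurableEmbedding (fun r : ℝ => (j, r)) := fun j =>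
    measurableEmbedding_prodMk_left j
  rw [queryLaw, ae_iff, Measure.finsetSum_apply]
  refine Finset.sum_eq_zero fun j _ => ?_
  rw [Measure.smul_apply, (he j).map_apply]
  have := hR.ae_mem j
  rw [ae_iff] at this
  simp only [Set.preimage_ofPred_eq, this, smul_zero]

lemma ae_instanceLaw (hR : R.DensityBoundedBelow α) (hp : ∀ j, 0 < p j)
    (hsum : ∑ j, p j = 1) (T : ℕ) :
    ∀ᵐ I ∂(instanceLaw p R T), ∀ t, (I t).2 ∈ Set.Icc (R.l (I t).1) (R.u (I t).1) := by
  have := isProbabilityMeasure_queryLaw hR hp hsum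
  refine Filter.eventually_all.2 fun t => ?_
  exact (Measure.tendsto_eval_ae_ae (μ := fun _ : Fin T => queryLaw p R) (i := t)).eventually
    (ae_queryLaw hR)

/-- Drawing one query afresh does not change the law of the instance. -/
lemma measurePreserving_update {X : Type*} [MeasurableSpace X] (ν : Measure X)
    [IsProbabilityMeasure ν] {T : ℕ} (t : Fin T) :
    MeasurePreserving (fun P : (Fin T → X) × X => Function.update P.1 t P.2)
      ((Measure.pi fun _ => ν).prod ν) (Measure.pi fun _ => ν) := by
  have hm : Measurable (fun P : (Fin T → X) × X => Function.update P.1 t P.2) := by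
    refine measurable_pi_iff.2 fun i => ?_
    by_cases h : i = t
    · subst h; simpa using measurable_snd
    · simpa [Function.update_of_ne h, Function.comp_def] using
        (measurable_pi_apply i).comp measurable_fst
  refine ⟨hm, ?_⟩
  symm
  refine Measure.pi_eq fun S hS => ?_
  rw [Measure.map_apply hm (MeasurableSet.univ_pi hS)]
  have : (fun P : (Fin T → X) × X => Function.update P.1 t P.2) ⁻¹' Set.univ.pi S =
      (Set.univ.pi (Function.update S t Set.univ)) ×ˢ S t := by
    ext ⟨I, x⟩
    simp only [Set.mem_preimage, Set.mem_pi, Set.mem_univ, true_implies, Set.mem_prod]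
    constructor
    · intro h
      refine ⟨fun i => ?_, by simpa using h t⟩
      by_cases hi : i = t
      · subst hi; simp
      · simpa [Function.update_of_ne hi] using h i
    · rintro ⟨h1, h2⟩ i
      by_cases hi : i = t
      · subst hi; simpa using h2
      · simpa [Function.update_of_ne hi] using h1 i
  rw [this, Measure.prod_prod, Measure.pi_pi, ← Finset.prod_erase_mul _ _ (Finset.mem_univ t),
    ← Finset.prod_erase_mul _ (fun i => ν (S i)) (Finset.mem_univ t)]
  rw [Function.update_self, measure_univ, mul_one]
  congr 1
  exact Finset.prod_congr rfl fun i hi => by rw [Function.update_of_ne (Finset.ne_of_mem_erase hi)]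

/-- To compare two expectations it suffices to compare them after averaging over one query. -/
lemma integral_le_of_update {X : Type*} [MeasurableSpace X] {ν : Measure X}
    [IsProbabilityMeasure ν] {T : ℕ} (t : Fin T) {f g : (Fin T → X) → ℝ}
    (hf : Integrable f (Measure.pi fun _ => ν)) (hg : Integrable g (Measure.pi fun _ => ν))
    (hfg : ∀ I, ∫ x, f (Function.update I t x) ∂ν ≤ ∫ x, g (Function.update I t x) ∂ν) :
    ∫ I, f I ∂(Measure.pi fun _ => ν) ≤ ∫ I, g I ∂(Measure.pi fun _ => ν) := by
  have hmp := measurePreserving_update ν t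
  have key : ∀ h : (Fin T → X) → ℝ, Integrable h (Measure.pi fun _ => ν) →
      Integrable (fun I => ∫ x, h (Function.update I t x) ∂ν) (Measure.pi fun _ => ν) ∧
      ∫ I, h I ∂(Measure.pi fun _ => ν) =
        ∫ I, ∫ x, h (Function.update I t x) ∂ν ∂(Measure.pi fun _ => ν) := by
    intro h hh
    have h1 := hmp.integrable_comp_of_integrable hh
    refine ⟨h1.integral_prod_left, ?_⟩
    refine Eq.trans ?_ (integral_prod _ h1)
    conv_lhs => rw [← hmp.map_eq]
    rw [integral_map hmp.measurable.aemeasurable]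
    · rfl
    · rw [hmp.map_eq]; exact hh.aestronglyMeasurable
  rw [(key f hf).2, (key g hg).2]
  exact integral_mono (key f hf).1 (key g hg).1 hfg

section Counts

variable {T : ℕ}

lemma remainingCount_eq_sum (I : Fin T → Fin n × ℝ) (k : ℕ) (j : Fin n) :
    remainingCount I k j = ∑ t : Fin T, if k ≤ (t : ℕ) ∧ (I t).1 = j then 1 else 0 := by
  rw [remainingCount, Finset.card_filter]

lemma measurable_remainingCount (k : ℕ) :
    Measurable fun I : Fin T → Fin n × ℝ => remainingCount I k := by
  refine measurable_pi_iff.2 fun j => ?_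
  simp only [remainingCount_eq_sum]
  refine Finset.measurable_sum _ fun t _ => Measurable.ite ?_ measurable_const measurable_const
  refine (MeasurableSet.const (k ≤ (t : ℕ))).inter ?_
  exact (measurable_fst.comp (measurable_pi_apply t)) (measurableSet_singleton j)

lemma remainingCount_eq_add_single (I : Fin T → Fin n × ℝ) (t : Fin T) :
    remainingCount I (t : ℕ) = remainingCount I ((t : ℕ) + 1) + Pi.single (I t).1 1 := by
  ext j
  rw [Pi.add_apply, remainingCount_eq_sum, remainingCount_eq_sum,
    ← Finset.add_sum_erase _ _ (Finset.mem_univ t),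
    ← Finset.add_sum_erase _ (fun i : Fin T => if (t : ℕ) + 1 ≤ (i : ℕ) ∧ (I i).1 = j then 1 else 0)
      (Finset.mem_univ t)]
  have h : ∀ i ∈ Finset.univ.erase t, (if (t : ℕ) ≤ (i : ℕ) ∧ (I i).1 = j then 1 else 0) =
      if (t : ℕ) + 1 ≤ (i : ℕ) ∧ (I i).1 = j then 1 else 0 := by
    intro i hi
    have hne : (i : ℕ) ≠ t := fun h => Finset.ne_of_mem_erase hi (Fin.ext h)
    have : (t : ℕ) ≤ (i : ℕ) ↔ (t : ℕ) + 1 ≤ (i : ℕ) := by omega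
    simp only [this]
  rw [Finset.sum_congr rfl h]
  by_cases hj : (I t).1 = j
  · subst hj; simp; ring
  · simp [hj]

lemma remainingCount_update (I : Fin T → Fin n × ℝ) (t : Fin T) (x : Fin n × ℝ) :
    remainingCount (Function.update I t x) ((t : ℕ) + 1) = remainingCount I ((t : ℕ) + 1) := by
  ext j
  simp only [remainingCount_eq_sum]
  refine Finset.sum_congr rfl fun i _ => ?_
  by_cases hi : i = t
  · subst hi; simp
  · rw [Function.update_of_ne hi]

lemma sum_remainingCount (I : Fin T → Fin n × ℝ) (k : ℕ) :
    ∑ j, remainingCount I k j = T - k := by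
  simp only [remainingCount_eq_sum]
  rw [Finset.sum_comm]
  have h : ∀ t : Fin T, ∑ j, (if k ≤ (t : ℕ) ∧ (I t).1 = j then 1 else 0) =
      if k ≤ (t : ℕ) then 1 else 0 := by
    intro t
    by_cases hk : k ≤ (t : ℕ) <;> simp [hk]
  simp only [h]
  rw [Fin.sum_univ_eq_sum_range (fun t => if k ≤ t then 1 else 0) T, ← Finset.card_filter]
  have : (Finset.range T).filter (fun t => k ≤ t) = Finset.Ico k T := by
    ext t; simp; omega
  rw [this, Nat.card_Ico]

end Counts

lemma measurableSet_typical (s : ℕ) : MeasurableSet {d : Fin n → ℕ | IsTypical p s d} :=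
  (Set.to_countable _).measurableSet

/-- Hoeffding's inequality: the type counts of the last `T - t` queries are typical, except with
probability `2 n / (T - t) ^ 2`. -/
lemma measureReal_not_typical_le (hR : R.DensityBoundedBelow α) (hp : ∀ j, 0 < p j)
    (hsum : ∑ j, p j = 1) {T : ℕ} (t : ℕ) (hs : 1 ≤ T - t) :
    (instanceLaw p R T).real {I | ¬ IsTypical p (T - t) (remainingCount I t)} ≤
      2 * n / ((T - t : ℕ) : ℝ) ^ 2 := by
  have hν := isProbabilityMeasure_queryLaw hR hp hsum
  have hπ : IsProbabilityMeasure (instanceLaw p R T) := by unfold instanceLaw; infer_instance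
  set s := T - t with hsdef
  have hs0 : (0 : ℝ) < s := by exact_mod_cast hs
  have hlog : 0 ≤ Real.log s := Real.log_nonneg (by exact_mod_cast hs)
  set τ : Finset (Fin T) := Finset.univ.filter fun i => t ≤ (i : ℕ) with hτ
  have hcard : (τ.card : ℝ) = s := by
    have h1 : τ.card = T - t := by
      rw [hτ, Finset.card_filter, Fin.sum_univ_eq_sum_range (fun i => if t ≤ i then 1 else 0) T,
        ← Finset.card_filter]
      have : (Finset.range T).filter (fun i => t ≤ i) = Finset.Ico t T := by
        ext i; simp; omega
      rw [this, Nat.card_Ico]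
    rw [h1]
  set ind : Fin n → Fin n × ℝ → ℝ := fun k x => if x.1 = k then 1 else 0 with hind
  have hindm : ∀ k, Measurable (ind k) := fun k =>
    Measurable.ite (measurable_fst (measurableSet_singleton k)) measurable_const measurable_const
  have hind01 : ∀ k x, ind k x ∈ Set.Icc (0 : ℝ) 1 := fun k x => by
    simp only [hind]; split_ifs <;> simp
  have hmean : ∀ k, ∫ x, ind k x ∂(queryLaw p R) = p k := fun k => by
    have h1 : ∀ j, IsProbabilityMeasure (R.F j) := hR.isProb
    have h2 : ∀ j, ∫ r, ind k (j, r) ∂(R.F j) = if j = k then 1 else 0 := fun j =>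
      (integral_const (μ := R.F j) (if j = k then (1 : ℝ) else 0)).trans (by simp)
    rw [integral_queryLaw hp fun j => integrable_const (μ := R.F j) (if j = k then (1 : ℝ) else 0)]
    simp [h2]
  have hmean' : ∀ k (i : Fin T), ∫ I, ind k (I i) ∂(instanceLaw p R T) = p k := fun k i => by
    have hmp : MeasurePreserving (Function.eval i) (instanceLaw p R T) (queryLaw p R) :=
      measurePreserving_eval _ i
    rw [← hmean k, ← hmp.map_eq, integral_map hmp.measurable.aemeasurable
      (hindm k).aestronglyMeasurable]
  have hcount : ∀ k (I : Fin T → Fin n × ℝ),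
      ∑ i ∈ τ, (ind k (I i) - p k) = (remainingCount I t k : ℝ) - s * p k := fun k I => by
    rw [Finset.sum_sub_distrib, Finset.sum_const, nsmul_eq_mul, hcard, remainingCount_eq_sum, hτ,
      Finset.sum_filter]
    push_cast
    congr 1
    refine Finset.sum_congr rfl fun i _ => ?_
    simp only [hind, ite_and]
  set δ := √(Real.log s / s) with hδ
  have hδ0 : 0 ≤ δ := Real.sqrt_nonneg _
  have htail : ∀ (k : Fin n) (σ : ℝ), σ ^ 2 = 1 → (instanceLaw p R T).real
      {I | s * δ ≤ ∑ i ∈ τ, σ * (ind k (I i) - p k)} ≤ 1 / (s : ℝ) ^ 2 := by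
    intro k σ hσ
    have hindep : iIndepFun (fun (i : Fin T) (I : Fin T → Fin n × ℝ) => σ * (ind k (I i) - p k))
        (instanceLaw p R T) :=
      iIndepFun_pi (X := fun _ x => σ * (ind k x - p k)) fun i =>
        (((hindm k).sub_const _).const_mul _).aemeasurable
    have hsub : ∀ i ∈ τ, HasSubgaussianMGF
        (fun I : Fin T → Fin n × ℝ => σ * (ind k (I i) - p k)) (1 / 4) (instanceLaw p R T) := by
      intro i _
      have h1 := (hasSubgaussianMGF_of_mem_Icc (μ := instanceLaw p R T)
        (X := fun I : Fin T → Fin n × ℝ => ind k (I i)) (a := 0) (b := 1)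
        ((hindm k).comp (measurable_pi_apply i)).aemeasurable
        (Filter.Eventually.of_forall fun I => hind01 k (I i))).const_mul σ
      simp only [hmean'] at h1
      let v : NNReal := ⟨σ ^ 2, sq_nonneg σ⟩
      have hv : v = 1 := NNReal.eq hσ
      have h3 : (1 / 4 : NNReal) = v * (‖(1 : ℝ) - 0‖₊ / 2) ^ 2 := by
        rw [hv, sub_zero, nnnorm_one, one_mul]
        norm_num
      rw [h3]
      exact h1
    refine (HasSubgaussianMGF.measure_sum_ge_le_of_iIndepFun hindep hsub
      (mul_nonneg hs0.le hδ0)).trans (le_of_eq ?_)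
    have h2 : ((∑ i ∈ τ, (1 / 4 : NNReal) : NNReal) : ℝ) = s / 4 := by
      rw [Finset.sum_const, nsmul_eq_mul, NNReal.coe_mul, NNReal.coe_natCast, hcard]
      norm_num
      ring
    have h3 : δ ^ 2 = Real.log s / s := Real.sq_sqrt (div_nonneg hlog hs0.le)
    have h4 : -(s * δ) ^ 2 / (2 * ((∑ i ∈ τ, (1 / 4 : NNReal) : NNReal) : ℝ)) =
        -(Real.log ((s : ℝ) ^ 2)) := by
      rw [h2, mul_pow, h3, Real.log_pow]
      push_cast
      field_simp
      ring
    push_cast at h4 ⊢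
    rw [h4, Real.exp_neg, Real.exp_log (by positivity), one_div]
  have hsubset : {I : Fin T → Fin n × ℝ | ¬ IsTypical p s (remainingCount I t)} ⊆
      ⋃ k : Fin n, ({I | s * δ ≤ ∑ i ∈ τ, 1 * (ind k (I i) - p k)} ∪
        {I | s * δ ≤ ∑ i ∈ τ, -1 * (ind k (I i) - p k)}) := by
    intro I hI
    simp only [IsTypical, Set.mem_ofPred_eq, not_forall, not_le] at hI
    obtain ⟨k, hk⟩ := hI
    refine Set.mem_iUnion.2 ⟨k, ?_⟩
    simp only [Set.mem_union, Set.mem_ofPred_eq, ← Finset.mul_sum, hcount]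
    have h1 : (remainingCount I t k : ℝ) - s * p k = s * ((remainingCount I t k : ℝ) / s - p k) := by
      field_simp
    rw [h1]
    rcases lt_abs.1 hk with h | h
    · left
      rw [one_mul]
      gcongr
    · right
      rw [neg_one_mul, ← mul_neg]
      gcongr
  calc _ ≤ (instanceLaw p R T).real (⋃ k : Fin n, ({I | s * δ ≤ ∑ i ∈ τ, 1 * (ind k (I i) - p k)} ∪
        {I | s * δ ≤ ∑ i ∈ τ, -1 * (ind k (I i) - p k)})) := measureReal_mono hsubset
    _ ≤ ∑ k : Fin n, (instanceLaw p R T).real ({I | s * δ ≤ ∑ i ∈ τ, 1 * (ind k (I i) - p k)} ∪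
        {I | s * δ ≤ ∑ i ∈ τ, -1 * (ind k (I i) - p k)}) := measureReal_iUnion_fintype_le _
    _ ≤ ∑ k : Fin n, (1 / (s : ℝ) ^ 2 + 1 / (s : ℝ) ^ 2) := Finset.sum_le_sum fun k _ =>
        (measureReal_union_le _ _).trans
          (add_le_add (htail k 1 (by norm_num)) (htail k (-1) (by norm_num)))
    _ = 2 * n / (s : ℝ) ^ 2 := by
        rw [Finset.sum_const, nsmul_eq_mul, Finset.card_univ, Fintype.card_fin]
        ring

end InstanceLaw

/-! ### The hindsight optimum -/

section Offline

/-- A maximizer over a finite set can be chosen measurably. -/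
lemma exists_measurable_argmax {Ω ι : Type*} [MeasurableSpace Ω] [MeasurableSpace ι] [Countable ι]
    [MeasurableSingletonClass ι] {S : Finset ι} (hS : S.Nonempty) {f : ι → Ω → ℝ}
    (hf : ∀ i, Measurable (f i)) :
    ∃ σ : Ω → ι, Measurable σ ∧ ∀ ω, σ ω ∈ S ∧ ∀ i ∈ S, f i ω ≤ f (σ ω) ω := by
  induction hS using Finset.Nonempty.cons_induction with
  | singleton i =>
    exact ⟨fun _ => i, measurable_const, fun ω => by simp⟩
  | cons i S hi hS ih =>
    obtain ⟨σ, hσm, hσ⟩ := ih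
    have hF : Measurable fun x : ι × Ω => f x.1 x.2 := measurable_from_prod_countable_right hf
    have hm : MeasurableSet {ω | f (σ ω) ω ≤ f i ω} :=
      measurableSet_le (hF.comp (hσm.prodMk measurable_id)) (hf i)
    classical
    refine ⟨fun ω => if f (σ ω) ω ≤ f i ω then i else σ ω,
      Measurable.ite hm measurable_const hσm, fun ω => ?_⟩
    obtain ⟨h1, h2⟩ := hσ ω
    dsimp only
    split_ifs with h
    · refine ⟨Finset.mem_cons_self _ _, fun k hk => ?_⟩
      rcases Finset.mem_cons.1 hk with rfl | hk
      · exact le_rfl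
      · exact (h2 k hk).trans h
    · refine ⟨Finset.mem_cons_of_mem h1, fun k hk => ?_⟩
      rcases Finset.mem_cons.1 hk with rfl | hk
      · exact (not_le.1 h).le
      · exact h2 k hk

variable {m n : ℕ} {a : Fin n → Fin m → ℝ} {p : Fin n → ℝ} {R : Rewards n} {α : ℝ}

/-- Given the types of all queries, the expected hindsight optimum is at most the semi-fluid
value: its acceptance frequencies are feasible proportions, and dual prices bound its rewards. -/
lemma integral_offlineValue_types_le (hR : R.DensityBoundedBelow α) {C : Fin m → ℝ}
    (hC : ∀ i, 0 ≤ C i) {T : ℕ} (τ : Fin T → Fin n) {d : Fin n → ℕ}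
    (hd : ∀ j, d j = (Finset.univ.filter fun t => τ t = j).card) :
    ∫ r, offlineValue a C (fun t => (τ t, r t)) ∂(Measure.pi fun t => R.F (τ t)) ≤
      semiFluid a R C d := by
  classical
  have hprob : ∀ j, IsProbabilityMeasure (R.F j) := hR.isProb
  set P := Measure.pi fun t => R.F (τ t) with hP
  set val : Bool → ℝ := fun b => if b then 1 else 0 with hval
  have hval01 : ∀ b, val b ∈ Set.Icc (0 : ℝ) 1 := fun b => by cases b <;> simp [hval]
  set S : Finset (Fin T → Bool) := Finset.univ.filter fun b =>
    ∀ i, ∑ t, a (τ t) i * val (b t) ≤ C i with hS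
  have hSne : S.Nonempty := ⟨fun _ => false, by simpa [hS, hval] using hC⟩
  obtain ⟨σ, hσm, hσ⟩ := exists_measurable_argmax (Ω := Fin T → ℝ) hSne
    (f := fun b r => ∑ t, r t * val (b t)) (fun b => by fun_prop)
  have hoff : ∀ r, offlineValue a C (fun t => (τ t, r t)) = ∑ t, r t * val (σ r t) := by
    intro r
    refine IsGreatest.csSup_eq ⟨⟨fun t => val (σ r t), fun t => ?_, ?_, rfl⟩, ?_⟩
    · cases σ r t <;> simp [hval]
    · simpa [hS] using (hσ r).1
    · rintro v ⟨x, hx01, hxC, rfl⟩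
      have hx : ∀ t, x t = val (decide (x t = 1)) := fun t => by
        rcases hx01 t with h | h <;> simp [hval, h]
      have hb : (fun t => decide (x t = 1)) ∈ S := by
        simp only [hS, Finset.mem_filter, Finset.mem_univ, true_and, ← hx]
        exact hxC
      have h := (hσ r).2 _ hb
      simp only [← hx] at h
      exact h
  have hxm : ∀ t, Measurable fun r => val (σ r t) := fun t =>
    (measurable_of_countable val).comp ((measurable_pi_apply t).comp hσm)
  have hae : ∀ t, ∀ᵐ r ∂P, r t ∈ Set.Icc (R.l (τ t)) (R.u (τ t)) := fun t =>
    (Measure.tendsto_eval_ae_ae (μ := fun t => R.F (τ t)) (i := t)).eventually (hR.ae_mem (τ t))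
  have hxi : ∀ t, Integrable (fun r => val (σ r t)) P := fun t =>
    Integrable.of_mem_Icc 0 1 (hxm t).aemeasurable (Filter.Eventually.of_forall fun r => hval01 _)
  have hrxi : ∀ t, Integrable (fun r => r t * val (σ r t)) P := fun t => by
    refine Integrable.of_bound ((measurable_pi_apply t).mul (hxm t)).aestronglyMeasurable
      (R.u (τ t)) ((hae t).mono fun r hr => ?_)
    have h0 : 0 ≤ r t := (hR (τ t)).1.trans hr.1
    have h1 := hval01 (σ r t)
    rw [Real.norm_eq_abs, abs_of_nonneg (mul_nonneg h0 h1.1)]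
    exact (mul_le_of_le_one_right h0 h1.2).trans hr.2
  -- `q j` is the expected fraction of the queries of type `j` that the optimum serves
  set X : Fin T → ℝ := fun t => ∫ r, val (σ r t) ∂P with hX
  have hX01 : ∀ t, X t ∈ Set.Icc (0 : ℝ) 1 := fun t =>
    ⟨integral_nonneg fun r => (hval01 _).1, by
      simpa using integral_mono (hxi t) (integrable_const (1 : ℝ)) fun r => (hval01 _).2⟩
  set q : Fin n → ℝ := fun j => (∑ t with τ t = j, X t) / d j with hq
  have hdq : ∀ j, (d j : ℝ) * q j = ∑ t with τ t = j, X t := by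
    intro j
    by_cases h : d j = 0
    · have h1 : (Finset.univ.filter fun t => τ t = j) = ∅ :=
        Finset.card_eq_zero.1 ((hd j).symm.trans h)
      simp [h, h1]
    · rw [hq]
      exact mul_div_cancel₀ _ (by exact_mod_cast h)
  have hfeas : IsFeasibleProportion a (fun j => (d j : ℝ)) C q := by
    refine ⟨fun j => ⟨div_nonneg (Finset.sum_nonneg fun t _ => (hX01 t).1) (Nat.cast_nonneg _),
      div_le_one_of_le₀ ?_ (Nat.cast_nonneg _)⟩, fun i => ?_⟩
    · refine (Finset.sum_le_sum fun t _ => (hX01 t).2).trans (le_of_eq ?_)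
      rw [Finset.sum_const, nsmul_eq_mul, mul_one, hd]
    · have h1 : ∑ j, (d j : ℝ) * a j i * q j = ∑ t, a (τ t) i * X t := by
        rw [← Finset.sum_fiberwise Finset.univ τ]
        refine Finset.sum_congr rfl fun j _ => ?_
        rw [mul_right_comm, hdq, Finset.sum_mul]
        refine Finset.sum_congr rfl fun t ht => ?_
        rw [(Finset.mem_filter.1 ht).2, mul_comm]
      have h2 : ∑ t, a (τ t) i * X t = ∫ r, ∑ t, a (τ t) i * val (σ r t) ∂P := by
        rw [integral_finsetSum _ fun t _ => (hxi t).const_mul _]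
        simp only [integral_const_mul, hX]
      rw [h1, h2]
      have h3 : ∀ r, ∑ t, a (τ t) i * val (σ r t) ≤ C i := fun r => by
        have := (hσ r).1
        simp only [hS, Finset.mem_filter, Finset.mem_univ, true_and] at this
        exact this i
      simpa using integral_mono (μ := P) (integrable_finsetSum _ fun t _ => (hxi t).const_mul _)
        (integrable_const (C i)) h3
  choose θ hθ using fun j => exists_topReward_eq (hR.ae_mem j) (hfeas.1 j)
  refine le_trans ?_ (le_semiFluid hR hfeas)
  simp only [hoff]
  rw [integral_finsetSum _ fun t _ => hrxi t]
  calc ∑ t, ∫ r, r t * val (σ r t) ∂P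
      ≤ ∑ t, (θ (τ t) * X t + ∫ r, max (r - θ (τ t)) 0 ∂(R.F (τ t))) := by
        refine Finset.sum_le_sum fun t _ => ?_
        have h1 := integral_mul_le_price (P := P) (measurable_pi_apply t) (hxm t) (hae t)
          (fun r => hval01 _) (θ (τ t))
        have hmp : MeasurePreserving (Function.eval t) P (R.F (τ t)) := measurePreserving_eval _ t
        have h2 : ∫ r, max (r - θ (τ t)) 0 ∂(R.F (τ t)) = ∫ r, max (r t - θ (τ t)) 0 ∂P := by
          rw [← hmp.map_eq, integral_map hmp.measurable.aemeasurable
            (by fun_prop : Measurable fun r : ℝ => max (r - θ (τ t)) 0).aestronglyMeasurable]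
        rw [h2]
        exact h1
    _ = ∑ j, (d j : ℝ) * topReward (R.F j) (q j) := by
        rw [← Finset.sum_fiberwise Finset.univ τ]
        refine Finset.sum_congr rfl fun j _ => ?_
        rw [hθ, mul_add, mul_left_comm, hdq, hd, ← nsmul_eq_mul, ← Finset.sum_const,
          Finset.mul_sum, ← Finset.sum_add_distrib]
        refine Finset.sum_congr rfl fun t ht => ?_
        rw [(Finset.mem_filter.1 ht).2]

/-- The law of an instance is the mixture, over all sequences of types, of the laws of independent
rewards. -/
lemma instanceLaw_eq_sum (hR : R.DensityBoundedBelow α) (hp : ∀ j, 0 < p j)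
    (hsum : ∑ j, p j = 1) (T : ℕ) :
    instanceLaw p R T = ∑ τ : Fin T → Fin n, (∏ t, ENNReal.ofReal (p (τ t))) •
      (Measure.pi fun t => R.F (τ t)).map (fun r t => (τ t, r t)) := by
  have hprob : ∀ j, IsProbabilityMeasure (R.F j) := hR.isProb
  have := isProbabilityMeasure_queryLaw hR hp hsum
  refine Measure.pi_eq fun S hS => ?_
  have hν : ∀ t, queryLaw p R (S t) =
      ∑ j, ENNReal.ofReal (p j) * R.F j ((fun r => (j, r)) ⁻¹' S t) := fun t => by
    rw [queryLaw, Measure.finsetSum_apply]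
    refine Finset.sum_congr rfl fun j _ => ?_
    rw [Measure.smul_apply, Measure.map_apply (by fun_prop) (hS t), smul_eq_mul]
  simp only [hν]
  rw [Finset.prod_univ_sum, Fintype.piFinset_univ, Measure.finsetSum_apply]
  refine Finset.sum_congr rfl fun τ _ => ?_
  have hpre : (fun (r : Fin T → ℝ) t => (τ t, r t)) ⁻¹' Set.univ.pi S =
      Set.univ.pi fun t => (fun r => (τ t, r)) ⁻¹' S t := by
    ext r; simp
  rw [Measure.smul_apply, Measure.map_apply (by fun_prop) (MeasurableSet.univ_pi hS), hpre,
    Measure.pi_pi, smul_eq_mul, Finset.prod_mul_distrib]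

lemma integral_instanceLaw (hR : R.DensityBoundedBelow α) (hp : ∀ j, 0 < p j)
    (hsum : ∑ j, p j = 1) {T : ℕ} {f : (Fin T → Fin n × ℝ) → ℝ}
    (hf : Integrable f (instanceLaw p R T)) :
    ∫ I, f I ∂(instanceLaw p R T) = ∑ τ : Fin T → Fin n, (∏ t, p (τ t)) *
      ∫ r, f (fun t => (τ t, r t)) ∂(Measure.pi fun t => R.F (τ t)) := by
  have hprob : ∀ j, IsProbabilityMeasure (R.F j) := hR.isProb
  rw [instanceLaw_eq_sum hR hp hsum] at hf ⊢
  have hf' := integrable_finsetSum_measure.1 hf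
  rw [integral_finsetSum_measure hf']
  refine Finset.sum_congr rfl fun τ hτ => ?_
  have hw : ∏ t, ENNReal.ofReal (p (τ t)) = ENNReal.ofReal (∏ t, p (τ t)) :=
    (ENNReal.ofReal_prod_of_nonneg fun t _ => (hp (τ t)).le).symm
  have hpos : 0 < ∏ t, p (τ t) := Finset.prod_pos fun t _ => hp (τ t)
  have h1 := hf' τ hτ
  rw [hw] at h1 ⊢
  rw [integrable_smul_measure (by simpa using hpos) ENNReal.ofReal_ne_top] at h1
  have hm : Measurable fun (r : Fin T → ℝ) t => (τ t, r t) := by fun_prop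
  rw [integral_smul_measure, integral_map hm.aemeasurable h1.aestronglyMeasurable,
    ENNReal.toReal_ofReal hpos.le, smul_eq_mul]

lemma integrable_semiFluid_remainingCount (hR : R.DensityBoundedBelow α) (hp : ∀ j, 0 < p j)
    (hsum : ∑ j, p j = 1) {C : Fin m → ℝ} (hC : ∀ i, 0 ≤ C i) (T k : ℕ) :
    Integrable (fun I => semiFluid a R C (remainingCount I k)) (instanceLaw p R T) := by
  have hν := isProbabilityMeasure_queryLaw hR hp hsum
  have hπ : IsProbabilityMeasure (instanceLaw p R T) := by unfold instanceLaw; infer_instance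
  have hU : ∀ j, R.u j ≤ ∑ k, R.u k := fun j =>
    Finset.single_le_sum (f := R.u) (fun k _ => hR.u_nonneg k) (Finset.mem_univ j)
  refine Integrable.of_mem_Icc 0 ((T - k : ℕ) * ∑ k, R.u k)
    ((measurable_of_countable (semiFluid a R C)).comp (measurable_remainingCount k)).aemeasurable
    (Filter.Eventually.of_forall fun I => ⟨semiFluid_nonneg hC hR _, ?_⟩)
  have := semiFluid_le_mul (a := a) hC hR hU (remainingCount I k)
  rwa [sum_remainingCount] at this

/-- The semi-fluid relaxation is an upper bound for the hindsight optimum, in expectation. -/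
lemma integral_offlineValue_le (hR : R.DensityBoundedBelow α) (hp : ∀ j, 0 < p j)
    (hsum : ∑ j, p j = 1) {C : Fin m → ℝ} (hC : ∀ i, 0 ≤ C i) (T : ℕ) :
    ∫ I, offlineValue a C I ∂(instanceLaw p R T) ≤
      ∫ I, semiFluid a R C (remainingCount I 0) ∂(instanceLaw p R T) := by
  by_cases hint : Integrable (fun I => offlineValue a C I) (instanceLaw p R T)
  swap
  · rw [integral_undef hint]
    exact integral_nonneg fun I => semiFluid_nonneg hC hR _
  have hprob : ∀ j, IsProbabilityMeasure (R.F j) := hR.isProb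
  rw [integral_instanceLaw hR hp hsum hint, integral_instanceLaw hR hp hsum
    (integrable_semiFluid_remainingCount hR hp hsum hC T 0)]
  refine Finset.sum_le_sum fun τ _ => mul_le_mul_of_nonneg_left ?_
    (Finset.prod_nonneg fun t _ => (hp (τ t)).le)
  have h1 : ∀ r : Fin T → ℝ, remainingCount (fun t => (τ t, r t)) 0 =
      fun j => (Finset.univ.filter fun t => τ t = j).card := fun r => by
    ext j; simp [remainingCount]
  simp only [h1]
  rw [integral_const, probReal_univ, one_smul]
  exact integral_offlineValue_types_le hR hC τ fun j => rfl

end Offline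

/-! ### The expected loss in a period -/

section ExpectedLoss

variable {m n : ℕ} {a : Fin n → Fin m → ℝ} {p : Fin n → ℝ} {R : Rewards n} {α : ℝ}

lemma integral_oneStepLoss_instance_le (M : ℕ → (Fin m → ℝ) → Fin n → ℝ)
    (hR : R.DensityBoundedBelow α) (hp : ∀ j, 0 < p j) (hsum : ∑ j, p j = 1) {U : ℝ} (hU0 : 0 ≤ U)
    (hU : ∀ j, R.u j ≤ U) {T : ℕ} (t : Fin T) {c : (Fin T → Fin n × ℝ) → Fin m → ℝ}
    (hc : ∀ I i, 0 ≤ c I i) :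
    ∫ I, oneStepLoss a R M (T - t) (c I) (remainingCount I (t + 1)) (I t) ∂(instanceLaw p R T) ≤
      (T - t : ℕ) * U := by
  have hν := isProbabilityMeasure_queryLaw hR hp hsum
  have hπ : IsProbabilityMeasure (instanceLaw p R T) := by unfold instanceLaw; infer_instance
  by_cases hint : Integrable (fun I : Fin T → Fin n × ℝ => oneStepLoss a R M (T - t) (c I)
      (remainingCount I (t + 1)) (I t)) (instanceLaw p R T)
  swap
  · rw [integral_undef hint]
    positivity
  have h := integral_mono_ae hint (integrable_const ((T - t : ℕ) * U))
    ((ae_instanceLaw hR hp hsum T).mono fun I hI => by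
      have h1 := oneStepLoss_le (a := a) M (T - t) hR hU (hc I) (remainingCount I (t + 1))
        (x := I t) ((hR _).1.trans (hI t).1)
      have h2 : T - ((t : ℕ) + 1) + 1 = T - t := by have := t.2; omega
      rwa [sum_remainingCount, h2] at h1)
  simpa using h

/-- In every period but the last one the expected loss is `O(log s / s)`, whatever the capacities
are, as long as they do not depend on the current query. -/
lemma exists_expectedLoss_le (hp : ∀ j, 0 < p j) (hsum : ∑ j, p j = 1)
    (ha : ∀ j i, 0 ≤ a j i) {κ α : ℝ} (hκ : 0 < κ) (hα : 0 < α) (U : ℝ) :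
    ∃ K : ℝ, 0 < K ∧ 2 * U ≤ K ∧ ∀ R : Rewards n, R.DensityBoundedBelow α → (∀ j, R.u j ≤ U) →
      IsSensitivityConstant p a R κ → ∀ qhat, IsFluidSolver p a R qhat →
      ∀ (T : ℕ) (t : Fin T) (c : (Fin T → Fin n × ℝ) → Fin m → ℝ), (∀ I i, 0 ≤ c I i) →
        (∀ I x, c (Function.update I t x) = c I) → 2 ≤ T - (t : ℕ) →
        ∫ I, oneStepLoss a R (boundaryEstimator R κ qhat) (T - t) (c I)
          (remainingCount I (t + 1)) (I t) ∂(instanceLaw p R T) ≤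
          K * (Real.log (T - t : ℕ) / (T - t : ℕ)) := by
  obtain ⟨K₁, S, hK₁, hbound⟩ := exists_integral_oneStepLoss_le p hp a ha hκ hα
  set V := max U 0 with hV
  have hV0 : 0 ≤ V := le_max_right _ _
  refine ⟨K₁ + 4 * n * V + 2 * S ^ 2 * V + 2 * V, by positivity, ?_, ?_⟩
  · have : U ≤ V := le_max_left _ _
    have h1 : 0 ≤ 4 * n * V := by positivity
    have h2 : 0 ≤ 2 * (S : ℝ) ^ 2 * V := by positivity
    linarith
  intro R hR hU hsens qhat hsolve T t c hc hupd hs2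
  have hUV : ∀ j, R.u j ≤ V := fun j => (hU j).trans (le_max_left _ _)
  have hν := isProbabilityMeasure_queryLaw hR hp hsum
  have hπ : IsProbabilityMeasure (instanceLaw p R T) := by unfold instanceLaw; infer_instance
  set M := boundaryEstimator R κ qhat with hM
  set s := T - (t : ℕ) with hs
  have hs0 : (0 : ℝ) < s := by positivity
  have hlog : 1 / 2 ≤ Real.log s := by
    have h1 : Real.log 2 ≤ Real.log s := Real.log_le_log two_pos (by exact_mod_cast hs2)
    linarith [Real.log_two_gt_d9]
  have hrate : 0 ≤ Real.log s / s := by positivity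
  rcases lt_or_ge s S with hsS | hsS
  · -- few periods remain: the constant absorbs the trivial bound
    refine (integral_oneStepLoss_instance_le M hR hp hsum hV0 hUV t hc).trans ?_
    have hsS' : (s : ℝ) ≤ S := by exact_mod_cast hsS.le
    have h1 : (s : ℝ) * V ≤ 2 * S ^ 2 * V * (Real.log s / s) := by
      calc (s : ℝ) * V = 2 * s ^ 2 * V * (1 / 2 / s) := by field_simp
        _ ≤ 2 * S ^ 2 * V * (Real.log s / s) := by gcongr
    have h2 : 0 ≤ (K₁ + 4 * n * V + 2 * V) * (Real.log s / s) := by positivity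
    change (s : ℝ) * V ≤ _
    linarith
  set f : (Fin T → Fin n × ℝ) → ℝ := fun I =>
    oneStepLoss a R M s (c I) (remainingCount I (t + 1)) (I t) with hf
  set B : Set (Fin T → Fin n × ℝ) := {I | ¬ IsTypical p s (remainingCount I t)} with hB
  have hBm : MeasurableSet B := (measurable_remainingCount (t : ℕ)) (measurableSet_typical s).compl
  set g : (Fin T → Fin n × ℝ) → ℝ := fun I =>
    K₁ * (Real.log s / s) + s * V * B.indicator (fun _ => 1) I with hg
  have hgi : Integrable g (instanceLaw p R T) :=
    (integrable_const _).add (((integrable_const (1 : ℝ)).indicator hBm).const_mul _)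
  have hgint : ∫ I, g I ∂(instanceLaw p R T) ≤ (K₁ + 4 * n * V) * (Real.log s / s) := by
    rw [hg, integral_add (integrable_const _) (((integrable_const (1 : ℝ)).indicator hBm).const_mul _),
      integral_const, integral_const_mul, integral_indicator_const _ hBm]
    have h1 : (instanceLaw p R T).real B ≤ 2 * n / (s : ℝ) ^ 2 :=
      measureReal_not_typical_le hR hp hsum (t : ℕ) (by omega)
    have h2 : s * V * (2 * n / (s : ℝ) ^ 2) ≤ 4 * n * V * (Real.log s / s) := by
      calc s * V * (2 * n / (s : ℝ) ^ 2) = 4 * n * V * (1 / 2 / s) := by field_simp; ring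
        _ ≤ _ := by gcongr
    have h3 : s * V * (instanceLaw p R T).real B ≤ s * V * (2 * n / (s : ℝ) ^ 2) := by gcongr
    simp only [probReal_univ, smul_eq_mul, one_mul, mul_one]
    linarith
  have hgnonneg : 0 ≤ ∫ I, g I ∂(instanceLaw p R T) := by
    refine integral_nonneg fun I => ?_
    have : 0 ≤ B.indicator (fun _ => (1 : ℝ)) I := Set.indicator_nonneg (fun _ _ => zero_le_one) _
    simp only [hg, Pi.zero_apply]
    positivity
  have hfg : ∫ I, f I ∂(instanceLaw p R T) ≤ ∫ I, g I ∂(instanceLaw p R T) := by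
    by_cases hint : Integrable f (instanceLaw p R T)
    swap
    · rwa [integral_undef hint]
    refine integral_le_of_update t hint hgi fun I => ?_
    set d := remainingCount I ((t : ℕ) + 1) with hd
    have hdsum : ∑ j, d j + 1 = s := by
      rw [hd, sum_remainingCount]; have := t.2; omega
    have e1 : ∀ x, f (Function.update I t x) = oneStepLoss a R M s (c I) d x := fun x => by
      simp only [hf, hupd, remainingCount_update, Function.update_self, hd]
    have e2 : ∀ x : Fin n × ℝ, g (Function.update I t x) = K₁ * (Real.log s / s) + s * V *
        {d' : Fin n → ℕ | ¬ IsTypical p s d'}.indicator (fun _ => 1) (d + Pi.single x.1 1) :=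
      fun x => by
        have h1 : remainingCount (Function.update I t x) (t : ℕ) = d + Pi.single x.1 1 := by
          rw [remainingCount_eq_add_single, remainingCount_update, Function.update_self]
        have h2 : Function.update I t x ∈ B ↔
            d + Pi.single x.1 1 ∈ {d' : Fin n → ℕ | ¬ IsTypical p s d'} := by
          simp only [hB, Set.mem_ofPred_eq, h1]
        by_cases h3 : d + Pi.single x.1 1 ∈ {d' : Fin n → ℕ | ¬ IsTypical p s d'}
        · simp only [hg, Set.indicator_of_mem h3, Set.indicator_of_mem (h2.2 h3)]
        · simp only [hg, Set.indicator_of_notMem h3, Set.indicator_of_notMem (mt h2.1 h3)]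
    simp only [e1, e2]
    rw [integral_queryLaw hp fun j => integrable_oneStepLoss M s hR (c I) d j,
      integral_queryLaw hp fun j => by
        have := hR.isProb j
        exact integrable_const (μ := R.F j) (K₁ * (Real.log s / s) + s * V *
          {d' : Fin n → ℕ | ¬ IsTypical p s d'}.indicator (fun _ => 1) (d + Pi.single j 1))]
    refine Finset.sum_le_sum fun j _ => mul_le_mul_of_nonneg_left ?_ (hp j).le
    have := hR.isProb j
    dsimp only
    rw [integral_const, probReal_univ, one_smul]
    by_cases htyp : IsTypical p s (d + Pi.single j 1)
    · rw [Set.indicator_of_notMem (by simpa using htyp), mul_zero, add_zero]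
      exact hbound R hR hsens qhat hsolve s hsS (c I) (hc I) d j hdsum htyp
    · rw [Set.indicator_of_mem (by simpa using htyp), mul_one]
      have h1 := integral_oneStepLoss_le (a := a) M s hR hUV (hc I) d j
      rw [hdsum] at h1
      have h2 : 0 ≤ K₁ * (Real.log s / s) := by positivity
      linarith
  calc ∫ I, f I ∂(instanceLaw p R T) ≤ (K₁ + 4 * n * V) * (Real.log s / s) := hfg.trans hgint
    _ ≤ _ := by
      have h2 : 0 ≤ 2 * (S : ℝ) ^ 2 * V := by positivity
      exact mul_le_mul_of_nonneg_right (by linarith) hrate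

lemma myopicRegret_eq (M : ℕ → (Fin m → ℝ) → Fin n → ℝ) (T : ℕ) (t : Fin T) (c : Fin m → ℝ) :
    myopicRegret p a R M T t c = ∫ I : Fin T → Fin n × ℝ,
      oneStepLoss a R M (T - t) c (remainingCount I (t + 1)) (I t) ∂(instanceLaw p R T) := by
  unfold myopicRegret oneStepLoss
  simp only [remainingCount_eq_add_single]

end ExpectedLoss

/-! ### Total regret -/

section Regret

variable {m n : ℕ} {a : Fin n → Fin m → ℝ} {p : Fin n → ℝ} {R : Rewards n} {α : ℝ}
  (M : ℕ → (Fin m → ℝ) → Fin n → ℝ) {C : Fin m → ℝ} {T : ℕ}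

lemma capacityAt_succ (I : Fin T → Fin n × ℝ) (t : Fin T) :
    capacityAt a M C I ((t : ℕ) + 1) =
      nextCapacity a M (T - t) (capacityAt a M C I t) (I t) := by
  rw [capacityAt, dif_pos t.2]

lemma capacityAt_nonneg (hC : ∀ i, 0 ≤ C i) (I : Fin T → Fin n × ℝ) (k : ℕ) (i : Fin m) :
    0 ≤ capacityAt a M C I k i := by
  induction k generalizing i with
  | zero => exact hC i
  | succ k ih =>
    rw [capacityAt]
    split_ifs with h
    · exact nextCapacity_nonneg M _ ih _ i
    · exact ih i

lemma capacityAt_update (I : Fin T → Fin n × ℝ) (t : Fin T) (x : Fin n × ℝ) {k : ℕ}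
    (hk : k ≤ t) : capacityAt a M C (Function.update I t x) k = capacityAt a M C I k := by
  induction k with
  | zero => rfl
  | succ k ih =>
    have hne : ∀ h : k < T, (⟨k, h⟩ : Fin T) ≠ t := fun h h' => by
      have : k = t := congrArg Fin.val h'
      omega
    simp only [capacityAt, ih (by omega)]
    split_ifs with h
    · rw [Function.update_of_ne (hne h)]
    · rfl

/-- Only countably many capacities can occur: they are determined by the numbers of served queries
of each type. This makes everything measurable without any assumption on the fluid solutions. -/
lemma exists_served_counts (C : Fin m → ℝ) (T k : ℕ) :
    ∃ N : (Fin T → Fin n × ℝ) → Fin n → ℕ, Measurable N ∧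
      ∀ I, capacityAt a M C I k = fun i => C i - ∑ j, a j i * N I j := by
  induction k with
  | zero => exact ⟨fun _ => 0, measurable_const, fun I => by simp [capacityAt]⟩
  | succ k ih =>
    obtain ⟨N, hN, hcap⟩ := ih
    by_cases h : k < T
    swap
    · exact ⟨N, hN, fun I => by rw [capacityAt, dif_neg h, hcap]⟩
    classical
    let Φ : ((Fin n → ℕ) × Fin n) × ℝ → Fin n → ℕ := fun y => y.1.1 +
      if decision a M (T - k) (fun i => C i - ∑ j, a j i * y.1.1 j) (y.1.2, y.2) = 1
        then Pi.single y.1.2 1 else 0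
    have hΦ : Measurable Φ := measurable_from_prod_countable_right fun y => by
      have hset : MeasurableSet {r : ℝ | decision a M (T - k)
          (fun i => C i - ∑ j, a j i * y.1 j) (y.2, r) = 1} :=
        measurable_decision M _ _ y.2 (measurableSet_singleton 1)
      have hite : Measurable fun r : ℝ => if decision a M (T - k)
          (fun i => C i - ∑ j, a j i * y.1 j) (y.2, r) = 1
            then (Pi.single y.2 1 : Fin n → ℕ) else 0 :=
        Measurable.ite hset measurable_const measurable_const
      exact hite.const_add y.1
    have hIk : Measurable fun I : Fin T → Fin n × ℝ => I ⟨k, h⟩ := measurable_pi_apply _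
    refine ⟨fun I => Φ ((N I, (I ⟨k, h⟩).1), (I ⟨k, h⟩).2),
      hΦ.comp ((hN.prodMk (measurable_fst.comp hIk)).prodMk (measurable_snd.comp hIk)),
      fun I => ?_⟩
    rw [capacityAt, dif_pos h, hcap]
    ext i
    simp only [nextCapacity, Φ, Prod.mk.eta]
    rcases decision_eq_zero_or_one M (T - k) (fun i => C i - ∑ j, a j i * N I j) (I ⟨k, h⟩)
      (a := a) with h0 | h0
    · simp [h0]
    · simp only [h0, if_true, cast_add_single, mul_add, Finset.sum_add_distrib]
      simp
      ring

lemma integrable_oneStepLoss_capacityAt (hR : R.DensityBoundedBelow α) (hp : ∀ j, 0 < p j)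
    (hsum : ∑ j, p j = 1) (hC : ∀ i, 0 ≤ C i) (t : Fin T) :
    Integrable (fun I : Fin T → Fin n × ℝ => oneStepLoss a R M (T - t) (capacityAt a M C I t)
      (remainingCount I (t + 1)) (I t)) (instanceLaw p R T) := by
  have hν := isProbabilityMeasure_queryLaw hR hp hsum
  have hπ : IsProbabilityMeasure (instanceLaw p R T) := by unfold instanceLaw; infer_instance
  set U := ∑ k, R.u k with hUdef
  have hU : ∀ j, R.u j ≤ U := fun j =>
    Finset.single_le_sum (f := R.u) (fun k _ => hR.u_nonneg k) (Finset.mem_univ j)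
  obtain ⟨N, hN, hcap⟩ := exists_served_counts (a := a) M C T (t : ℕ)
  let Φ : ((Fin n → ℕ) × (Fin n → ℕ) × Fin n) × ℝ → ℝ := fun y =>
    oneStepLoss a R M (T - t) (fun i => C i - ∑ j, a j i * y.1.1 j) y.1.2.1 (y.1.2.2, y.2)
  have hΦ : Measurable Φ := measurable_from_prod_countable_right fun y => by
    simp only [Φ, oneStepLoss_eq]
    have := measurable_decision (a := a) M (T - t) (fun i => C i - ∑ j, a j i * y.1 j) y.2.2
    fun_prop
  have hIt : Measurable fun I : Fin T → Fin n × ℝ => I t := measurable_pi_apply _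
  have hm : Measurable fun I : Fin T → Fin n × ℝ => oneStepLoss a R M (T - t)
      (capacityAt a M C I t) (remainingCount I (t + 1)) (I t) := by
    have h1 := hΦ.comp ((hN.prodMk ((measurable_remainingCount ((t : ℕ) + 1)).prodMk
      (measurable_fst.comp hIt))).prodMk (measurable_snd.comp hIt))
    convert h1 using 1
    ext I
    simp only [hcap, Φ, Function.comp_apply, Prod.mk.eta]
  refine Integrable.of_mem_Icc (-((T - (t + 1) : ℕ) * U + U)) ((T - (t + 1) + 1 : ℕ) * U)
    hm.aemeasurable ((ae_instanceLaw hR hp hsum T).mono fun I hI => ⟨?_, ?_⟩)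
  · have hcn := capacityAt_nonneg (a := a) M hC I t
    have h1 := semiFluid_nonneg (a := a) hcn hR (remainingCount I (t + 1) + Pi.single (I t).1 1)
    have h2 := semiFluid_le_mul (a := a) (nextCapacity_nonneg (a := a) M (T - t) hcn (I t)) hR hU
      (remainingCount I (t + 1))
    rw [sum_remainingCount] at h2
    have h3 : (I t).2 * decision a M (T - t) (capacityAt a M C I t) (I t) ≤ U := by
      rcases decision_eq_zero_or_one M (T - t) (capacityAt a M C I t) (I t) (a := a) with h | h
      · rw [h, mul_zero]; exact (hR.u_nonneg (I t).1).trans (hU _)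
      · rw [h, mul_one]; exact (hI t).2.trans (hU _)
    unfold oneStepLoss
    linarith
  · have h1 := oneStepLoss_le (a := a) M (T - t) hR hU (capacityAt_nonneg (a := a) M hC I t)
      (remainingCount I (t + 1)) (x := I t) ((hR _).1.trans (hI t).1)
    rwa [sum_remainingCount] at h1

/-- The semi-fluid value of the initial state is the reward of the policy plus its losses. -/
lemma policyValue_eq (hR : R.DensityBoundedBelow α) (hC : ∀ i, 0 ≤ C i) (I : Fin T → Fin n × ℝ) :
    policyValue a M C I = semiFluid a R C (remainingCount I 0) -
      ∑ t : Fin T, oneStepLoss a R M (T - t) (capacityAt a M C I t) (remainingCount I (t + 1))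
        (I t) := by
  set g : ℕ → ℝ := fun k => semiFluid a R (capacityAt a M C I k) (remainingCount I k) with hg
  have hU : ∀ j, R.u j ≤ ∑ k, R.u k := fun j =>
    Finset.single_le_sum (f := R.u) (fun k _ => hR.u_nonneg k) (Finset.mem_univ j)
  have hgT : g T = 0 := by
    have hcn := capacityAt_nonneg (a := a) M hC I T
    refine le_antisymm ?_ (semiFluid_nonneg hcn hR _)
    have := semiFluid_le_mul (a := a) hcn hR hU (remainingCount I T)
    rwa [sum_remainingCount, Nat.sub_self, Nat.cast_zero, zero_mul] at this
  have hloss : ∀ t : Fin T, oneStepLoss a R M (T - t) (capacityAt a M C I t)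
      (remainingCount I (t + 1)) (I t) = (g t - g (t + 1)) -
        (I t).2 * decision a M (T - t) (capacityAt a M C I t) (I t) := fun t => by
    rw [oneStepLoss, ← remainingCount_eq_add_single, ← capacityAt_succ]
  have htel : ∑ t : Fin T, (g t - g (t + 1)) = g 0 := by
    rw [Fin.sum_univ_eq_sum_range (fun k => g k - g (k + 1)) T, Finset.sum_range_sub', hgT,
      sub_zero]
  simp only [hloss, Finset.sum_sub_distrib (f := fun t : Fin T => g t - g (t + 1)), htel]
  simp only [policyValue, hg, capacityAt]
  ring

lemma regret_le_sum (hR : R.DensityBoundedBelow α) (hp : ∀ j, 0 < p j) (hsum : ∑ j, p j = 1)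
    (hC : ∀ i, 0 ≤ C i) :
    regret p a R M T C ≤ ∑ t : Fin T, ∫ I : Fin T → Fin n × ℝ,
      oneStepLoss a R M (T - t) (capacityAt a M C I t) (remainingCount I (t + 1)) (I t)
        ∂(instanceLaw p R T) := by
  have hi := fun t : Fin T => integrable_oneStepLoss_capacityAt (a := a) M hR hp hsum hC t
  have h1 : ∫ I, policyValue a M C I ∂(instanceLaw p R T) =
      ∫ I, semiFluid a R C (remainingCount I 0) ∂(instanceLaw p R T) -
      ∑ t : Fin T, ∫ I : Fin T → Fin n × ℝ,
        oneStepLoss a R M (T - t) (capacityAt a M C I t) (remainingCount I (t + 1)) (I t)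
          ∂(instanceLaw p R T) := by
    simp only [policyValue_eq M hR hC]
    rw [integral_sub (integrable_semiFluid_remainingCount hR hp hsum hC T 0)
      (integrable_finsetSum _ fun t _ => hi t), integral_finsetSum _ fun t _ => hi t]
  have h2 := integral_offlineValue_le (a := a) hR hp hsum hC T
  rw [regret, h1]
  linarith

lemma sum_inv_le (T : ℕ) : ∑ t : Fin T, 1 / ((T - (t : ℕ) : ℕ) : ℝ) ≤ 1 + Real.log T := by
  have h1 : ∑ t : Fin T, 1 / ((T - (t : ℕ) : ℕ) : ℝ) = (harmonic T : ℝ) := by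
    rw [Fin.sum_univ_eq_sum_range (fun k => 1 / ((T - k : ℕ) : ℝ)) T, harmonic,
      ← Finset.sum_range_reflect]
    push_cast
    refine Finset.sum_congr rfl fun k hk => ?_
    have hk := Finset.mem_range.1 hk
    have : T - (T - 1 - k) = k + 1 := by omega
    rw [this, one_div]
    push_cast
    rfl
  rw [h1]
  exact harmonic_le_one_add_log T

end Regret

end NRM

theorem theorem1 {n : ℕ} (p : Fin n → ℝ) (hp : ∀ j, 0 < p j) (hsum : ∑ j, p j = 1) :
    -- `s₀` depends on `p` only
    ∃ s₀ : ℕ, ∀ {m : ℕ} (a : Fin n → Fin m → ℝ), (∀ j i, 0 ≤ a j i) →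
      -- sensitivity constants exist, depending on `p` and `a` only
      (∃ κ₁ : ℝ, 0 < κ₁ ∧ ∀ (R : NRM.Rewards n) (α : ℝ), 0 < α → R.DensityBoundedBelow α →
        NRM.IsSensitivityConstant p a R κ₁) ∧
      -- the policy run with any such constant has small myopic regret and small total regret
      ∀ κ₁ : ℝ, 0 < κ₁ → ∀ α : ℝ, 0 < α → ∀ U : ℝ, ∃ κ₂ : ℝ, 0 < κ₂ ∧
        ∀ R : NRM.Rewards n, R.DensityBoundedBelow α → (∀ j, R.u j ≤ U) →
          NRM.IsSensitivityConstant p a R κ₁ →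
          ∀ qhat : ℕ → (Fin m → ℝ) → Fin n → ℝ, NRM.IsFluidSolver p a R qhat →
            (∀ (T : ℕ) (t : Fin T) (c : Fin m → ℝ), (∀ i, 0 ≤ c i) → s₀ ≤ T - (t : ℕ) →
              NRM.myopicRegret p a R (NRM.boundaryEstimator R κ₁ qhat) T t c ≤
                κ₂ * Real.log ((T - (t : ℕ) : ℕ) : ℝ) / ((T - (t : ℕ) : ℕ) : ℝ)) ∧
            (∀ (T : ℕ) (C : Fin m → ℝ), 2 ≤ T → (∀ i, 0 ≤ C i) →
              NRM.regret p a R (NRM.boundaryEstimator R κ₁ qhat) T C ≤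
                κ₂ * Real.log T ^ 2) := by
  open NRM in
  -- `log s` is bounded below for `s ≥ 2`, so `κ₂` can absorb all smaller numbers of periods
  refine ⟨2, fun a ha => ⟨?_, fun κ hκ α hα U => ?_⟩⟩
  · obtain ⟨κ, hκ, h⟩ := exists_sensitivityConstant p hp a ha
    exact ⟨κ, hκ, fun R α _ hR => h R α hR⟩
  obtain ⟨K, hK, hUK, hloss⟩ := exists_expectedLoss_le (a := a) hp hsum ha hκ hα U
  refine ⟨3 * K, by positivity, fun R hR hU hsens qhat hsolve => ⟨?_, ?_⟩⟩
  · intro T t c hc hs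
    have h := hloss R hR hU hsens qhat hsolve T t (fun _ => c) (fun _ => hc) (fun _ _ => rfl) hs
    rw [myopicRegret_eq, mul_div_assoc]
    refine h.trans (mul_le_mul_of_nonneg_right (by linarith) ?_)
    have : 0 ≤ Real.log ((T - (t : ℕ) : ℕ) : ℝ) := Real.log_natCast_nonneg _
    positivity
  · intro T C hT hC
    set M := boundaryEstimator R κ qhat with hM
    have hlogT : 1 / 2 ≤ Real.log T := by
      have h1 : Real.log 2 ≤ Real.log T := Real.log_le_log two_pos (by exact_mod_cast hT)
      linarith [Real.log_two_gt_d9]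
    have hU0 : 0 ≤ U := by
      rcases isEmpty_or_nonempty (Fin n) with h | ⟨⟨j⟩⟩
      · simp at hsum
      · exact (hR.u_nonneg j).trans (hU j)
    have hterm : ∀ t : Fin T, ∫ I : Fin T → Fin n × ℝ, oneStepLoss a R M (T - t)
        (capacityAt a M C I t) (remainingCount I (t + 1)) (I t) ∂(instanceLaw p R T) ≤
        K * Real.log T * (1 / ((T - (t : ℕ) : ℕ) : ℝ)) := by
      intro t
      have hcn : ∀ (I : Fin T → Fin n × ℝ) i, 0 ≤ capacityAt a M C I t i := fun I =>
        capacityAt_nonneg M hC I t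
      rcases Nat.lt_or_ge (T - (t : ℕ)) 2 with hs | hs
      · have hs1 : T - (t : ℕ) = 1 := by have := t.2; omega
        refine (integral_oneStepLoss_instance_le M hR hp hsum hU0 hU t hcn).trans ?_
        rw [hs1]
        push_cast
        nlinarith
      · refine (hloss R hR hU hsens qhat hsolve T t (fun I => capacityAt a M C I t) hcn
          (fun I x => capacityAt_update M I t x le_rfl) hs).trans ?_
        rw [mul_assoc, mul_one_div]
        have h0 : (0 : ℝ) < ((T - (t : ℕ) : ℕ) : ℝ) := by exact_mod_cast (by omega : 0 < T - (t : ℕ))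
        gcongr
        exact Nat.sub_le _ _
    calc regret p a R M T C ≤ ∑ t : Fin T, K * Real.log T * (1 / ((T - (t : ℕ) : ℕ) : ℝ)) :=
          (regret_le_sum M hR hp hsum hC).trans (Finset.sum_le_sum fun t _ => hterm t)
      _ = K * Real.log T * ∑ t : Fin T, 1 / ((T - (t : ℕ) : ℕ) : ℝ) := by rw [Finset.mul_sum]
      _ ≤ K * Real.log T * (1 + Real.log T) := by
          gcongr
          exact sum_inv_le T
      _ ≤ K * Real.log T * (3 * Real.log T) := by
          gcongr
          linarith
      _ = 3 * K * Real.log T ^ 2 := by ring
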